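/- Let $d>0$, $T>0$, and let $b,\sigma\in\mathbb R$ be nonzero. Define $a_0=1$ and $a_{n+1}=a_n-\frac{d}{a_n}\left(\frac b\sigma\right)^2$ for $n\ge 0$, assume $a_1>0$ (that is, $d\,b^2<\sigma^2$), and let $\mathcal N=\mathcal N(d,b,\sigma)=\inf\{n\ge 1: a_n>0 \text{ and } a_{n+1}\le 0\}$. Consider the Riccati system for $P=(P_{11},P_{12},P_{\hat{22}},P_{22})$, where $P_{11}:[0,T]\to\mathbb R$, $P_{12},P_{\hat{22}}:[0,T]\times[-d,0]\to\mathbb R$ and $P_{22}:[0,T]\times[-d,0]^2\to\mathbb R$: $$\dot P_{11}(t)=\frac{P_{12}(t,0)^2}{P_{\hat{22}}(t,0)},\qquad (\partial_t-\partial_s)P_{12}(t,s)=\frac{P_{12}(t,0)P_{22}(t,s,0)}{P_{\hat{22}}(t,0)},$$ $$(\partial_t-\partial_s)P_{\hat{22}}(t,s)=0,\qquad (\partial_t-\partial_s-\partial_r)P_{22}(t,s,r)=\frac{P_{22}(t,s,0)P_{22}(t,0,r)}{P_{\hat{22}}(t,0)},$$ with the boundary conditions $$P_{12}(t,-d)=bP_{11}(t),\quad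 P_{\hat{22}}(t,-d)=\sigma^2P_{11}(t),\quad P_{22}(t,s,-d)=bP_{12}(t,s),\quad P_{22}(t,-d,r)=bP_{12}(t,r),$$ and the final conditions $$P_{11}(T)=1,\qquad P_{12}(T,s)=P_{\hat{22}}(T,s)=P_{22}(T,s,r)=0,$$ for almost every $s,r\in[-d,0]$, with the convention $0^2/0=0$. A solution is a quadruple $P$ such that: $P_{11}$ is absolutely continuous on $[0,T]$; the other kernels are piecewise absolutely continuous, i.e. on each of the three pieces $\{t\le T-d\}$, $\{t>T-d,\ t+m<T-d\}$, $\{t>T-d,\ t+m>T-d\}$ of the domain (with $m=s$ for $P_{12},P_{\hat{22}}$ and $m=\max(s,r)$ for $P_{22}$) they coincide with a function that, on the closure of the piece, is continuous and is absolutely continuous in each variable; the equations hold, $\partial_t-\partial_s$ and $\partial_t-\partial_s-\partial_r$ being the derivatives along the characteristic lines $t+s=u$, respectively $t+s=u,\ t+r=v$ (along every such line not contained in the surface $t+m=T-d$, the kernel is absolutely continuous and the equation holds almost everywhere); the boundary and final conditions hold; and $P_{\hat{22}}(t,\cdot)>0$ for every $t<T-d$. Assume $\mathcal N\ge 2$ and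 $T<\mathcal N d$. Then the system has a solution on $[0,T]$. It is unique: any two solutions have the same $P_{11}$ on $[0,T]$ and the same $P_{12},P_{\hat{22}},P_{22}$ on all three pieces, i.e. everywhere except possibly on the null set $\{t>T-d,\ t+m=T-d\}$ on which these kernels jump. Moreover $0<a_{\mathcal N}\le P_{11}(0)\le 1$, and $P_{11}(0)<1$ if $T>d$. -/

import Mathlib

/-- The sequence `a 0 = 1`, `a (n + 1) = a n - (d / a n) * (b / σ) ^ 2`. -/
noncomputable def riccatiSeq (d b σ : ℝ) : ℕ → ℝ
  | 0 => 1
  | n + 1 => riccatiSeq d b σ n - d / riccatiSeq d b σ n * (b / σ) ^ 2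

/-- The first index `n ≥ 1` with `a n > 0` and `a (n + 1) ≤ 0` (it is `0` if there is no such
index, which cannot happen when it is assumed to be at least `2`). -/
noncomputable def riccatiIndex (d b σ : ℝ) : ℕ :=
  sInf {n : ℕ | 1 ≤ n ∧ 0 < riccatiSeq d b σ n ∧ riccatiSeq d b σ (n + 1) ≤ 0}

/-- A quadruple of kernels `(P₁₁, P₁₂, P̂₂₂, P₂₂)`. Only the values for `t ∈ [0, T]` and
`s, r ∈ [-d, 0]` matter. -/
structure RiccatiKernel where
  P11 : ℝ → ℝ
  P12 : ℝ → ℝ → ℝ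
  P22hat : ℝ → ℝ → ℝ
  P22 : ℝ → ℝ → ℝ → ℝ

namespace RiccatiKernel

/-! ### The pieces of the domain

The box `[0, T] × [-d, 0]` (resp. `[0, T] × [-d, 0]²`) is cut into three pieces: `t ≤ T - d`;
`t > T - d` and `t + s < T - d` (resp. `t + max s r < T - d`); `t > T - d` and `t + s > T - d`
(resp. `t + max s r > T - d`). What remains is the null set on which the kernels jump. -/

/-- The piece `t ≤ T - d`. -/
def domA₂ (d T : ℝ) : Set (ℝ × ℝ) :=
  {p | 0 ≤ p.1 ∧ p.1 ≤ T - d ∧ p.2 ∈ Set.Icc (-d) 0}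

/-- The piece below the jump surface, for `t > T - d`. -/
def domB₂ (d T : ℝ) : Set (ℝ × ℝ) :=
  {p | p.1 ∈ Set.Icc 0 T ∧ T - d < p.1 ∧ p.2 ∈ Set.Icc (-d) 0 ∧ p.1 + p.2 < T - d}

/-- The piece above the jump surface, for `t > T - d`. -/
def domC₂ (d T : ℝ) : Set (ℝ × ℝ) :=
  {p | p.1 ∈ Set.Icc 0 T ∧ T - d < p.1 ∧ p.2 ∈ Set.Icc (-d) 0 ∧ T - d < p.1 + p.2}

/-- The piece `t ≤ T - d`. -/
def domA₃ (d T : ℝ) : Set (ℝ × ℝ × ℝ) :=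
  {p | 0 ≤ p.1 ∧ p.1 ≤ T - d ∧ p.2.1 ∈ Set.Icc (-d) 0 ∧ p.2.2 ∈ Set.Icc (-d) 0}

/-- The piece below the jump surface, for `t > T - d`. -/
def domB₃ (d T : ℝ) : Set (ℝ × ℝ × ℝ) :=
  {p | p.1 ∈ Set.Icc 0 T ∧ T - d < p.1 ∧ p.2.1 ∈ Set.Icc (-d) 0 ∧ p.2.2 ∈ Set.Icc (-d) 0 ∧
    p.1 + max p.2.1 p.2.2 < T - d}

/-- The piece above the jump surface, for `t > T - d`. -/
def domC₃ (d T : ℝ) : Set (ℝ × ℝ × ℝ) :=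
  {p | p.1 ∈ Set.Icc 0 T ∧ T - d < p.1 ∧ p.2.1 ∈ Set.Icc (-d) 0 ∧ p.2.2 ∈ Set.Icc (-d) 0 ∧
    T - d < p.1 + max p.2.1 p.2.2}

/-! ### Piecewise absolute continuity -/

/-- `f` is absolutely continuous on `S`: jointly continuous on `S`, and absolutely continuous in
each variable on every segment parallel to an axis that lies in `S`. -/
def ACOn₂ (f : ℝ → ℝ → ℝ) (S : Set (ℝ × ℝ)) : Prop :=
  ContinuousOn (fun p : ℝ × ℝ => f p.1 p.2) S ∧
  (∀ s x y : ℝ, x ≤ y → (∀ t ∈ Set.Icc x y, (t, s) ∈ S) →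
    AbsolutelyContinuousOnInterval (fun t => f t s) x y) ∧
  (∀ t x y : ℝ, x ≤ y → (∀ s ∈ Set.Icc x y, (t, s) ∈ S) →
    AbsolutelyContinuousOnInterval (fun s => f t s) x y)

/-- The analogue of `ACOn₂` for three variables. -/
def ACOn₃ (f : ℝ → ℝ → ℝ → ℝ) (S : Set (ℝ × ℝ × ℝ)) : Prop :=
  ContinuousOn (fun p : ℝ × ℝ × ℝ => f p.1 p.2.1 p.2.2) S ∧
  (∀ s r x y : ℝ, x ≤ y → (∀ t ∈ Set.Icc x y, (t, s, r) ∈ S) →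
    AbsolutelyContinuousOnInterval (fun t => f t s r) x y) ∧
  (∀ t r x y : ℝ, x ≤ y → (∀ s ∈ Set.Icc x y, (t, s, r) ∈ S) →
    AbsolutelyContinuousOnInterval (fun s => f t s r) x y) ∧
  (∀ t s x y : ℝ, x ≤ y → (∀ r ∈ Set.Icc x y, (t, s, r) ∈ S) →
    AbsolutelyContinuousOnInterval (fun r => f t s r) x y)

/-- `f` is piecewise absolutely continuous on `[0, T] × [-d, 0]`: on each of the three pieces it
coincides with a function that is absolutely continuous on the closure of the piece. -/
def PiecewiseAC₂ (d T : ℝ) (f : ℝ → ℝ → ℝ) : Prop :=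
  ∀ S ∈ ({domA₂ d T, domB₂ d T, domC₂ d T} : Set (Set (ℝ × ℝ))),
    ∃ g : ℝ → ℝ → ℝ, ACOn₂ g (closure S) ∧ ∀ p ∈ S, f p.1 p.2 = g p.1 p.2

/-- `f` is piecewise absolutely continuous on `[0, T] × [-d, 0]²`. -/
def PiecewiseAC₃ (d T : ℝ) (f : ℝ → ℝ → ℝ → ℝ) : Prop :=
  ∀ S ∈ ({domA₃ d T, domB₃ d T, domC₃ d T} : Set (Set (ℝ × ℝ × ℝ))),
    ∃ g : ℝ → ℝ → ℝ → ℝ, ACOn₃ g (closure S) ∧ ∀ p ∈ S, f p.1 p.2.1 p.2.2 = g p.1 p.2.1 p.2.2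

/-! ### The transport operators

`∂ₜ - ∂ₛ` and `∂ₜ - ∂ₛ - ∂ᵣ` are the derivatives along the lines `t + s = u`, respectively
`t + s = u`, `t + r = v`. The lines that lie in the jump surface are left out. -/

/-- `(∂ₜ - ∂ₛ) f = g` on `[0, T] × [-d, 0]`: along each line `t + s = u`, the function `f` is
absolutely continuous, with derivative `g` almost everywhere. -/
def Transport₂ (d T : ℝ) (f g : ℝ → ℝ → ℝ) : Prop :=
  ∀ u : ℝ, max 0 u < min T (u + d) → u ≠ T - d →
    AbsolutelyContinuousOnInterval (fun t => f t (u - t)) (max 0 u) (min T (u + d)) ∧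
    ∀ᵐ t : ℝ, t ∈ Set.Ioo (max 0 u) (min T (u + d)) →
      HasDerivAt (fun t => f t (u - t)) (g t (u - t)) t

/-- `(∂ₜ - ∂ₛ - ∂ᵣ) f = g` on `[0, T] × [-d, 0]²`: along each line `t + s = u`, `t + r = v`, the
function `f` is absolutely continuous, with derivative `g` almost everywhere. -/
def Transport₃ (d T : ℝ) (f g : ℝ → ℝ → ℝ → ℝ) : Prop :=
  ∀ u v : ℝ, max 0 (max u v) < min T (min u v + d) → max u v ≠ T - d →
    AbsolutelyContinuousOnInterval (fun t => f t (u - t) (v - t))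
      (max 0 (max u v)) (min T (min u v + d)) ∧
    ∀ᵐ t : ℝ, t ∈ Set.Ioo (max 0 (max u v)) (min T (min u v + d)) →
      HasDerivAt (fun t => f t (u - t) (v - t)) (g t (u - t) (v - t)) t

/-- `P` is a solution of the Riccati system on `[0, T]` with delay `d` and coefficients `b`, `σ`.
The convention `0 ^ 2 / 0 = 0` of the system is the one of division in `ℝ`. -/
structure IsSolution (d b σ T : ℝ) (P : RiccatiKernel) : Prop where
  ac11 : AbsolutelyContinuousOnInterval P.P11 0 T
  ac12 : PiecewiseAC₂ d T P.P12
  ac22hat : PiecewiseAC₂ d T P.P22hat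
  ac22 : PiecewiseAC₃ d T P.P22
  eq11 : ∀ᵐ t : ℝ, t ∈ Set.Ioo 0 T → HasDerivAt P.P11 (P.P12 t 0 ^ 2 / P.P22hat t 0) t
  eq12 : Transport₂ d T P.P12 (fun t s => P.P12 t 0 * P.P22 t s 0 / P.P22hat t 0)
  eq22hat : Transport₂ d T P.P22hat (fun _ _ => 0)
  eq22 : Transport₃ d T P.P22 (fun t s r => P.P22 t s 0 * P.P22 t 0 r / P.P22hat t 0)
  bdry12 : ∀ t ∈ Set.Icc 0 T, P.P12 t (-d) = b * P.P11 t
  bdry22hat : ∀ t ∈ Set.Icc 0 T, P.P22hat t (-d) = σ ^ 2 * P.P11 t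
  bdry22_right : ∀ t ∈ Set.Icc 0 T, ∀ᵐ s : ℝ, s ∈ Set.Icc (-d) 0 →
    P.P22 t s (-d) = b * P.P12 t s
  bdry22_left : ∀ t ∈ Set.Icc 0 T, ∀ᵐ r : ℝ, r ∈ Set.Icc (-d) 0 →
    P.P22 t (-d) r = b * P.P12 t r
  final11 : P.P11 T = 1
  final12 : ∀ᵐ s : ℝ, s ∈ Set.Icc (-d) 0 → P.P12 T s = 0
  final22hat : ∀ᵐ s : ℝ, s ∈ Set.Icc (-d) 0 → P.P22hat T s = 0
  final22 : ∀ᵐ p : ℝ × ℝ, p.1 ∈ Set.Icc (-d) 0 → p.2 ∈ Set.Icc (-d) 0 → P.P22 T p.1 p.2 = 0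
  pos22hat : ∀ t ∈ Set.Icc 0 T, t < T - d → ∀ s ∈ Set.Icc (-d) 0, 0 < P.P22hat t s

/-- `P` and `Q` coincide on `[0, T]`: the first components everywhere, the other ones on all the
pieces of the domain, that is, off the null set `t > T - d`, `t + s = T - d`
(resp. `t + max s r = T - d`). -/
def Agree (d T : ℝ) (P Q : RiccatiKernel) : Prop :=
  (∀ t ∈ Set.Icc 0 T, P.P11 t = Q.P11 t) ∧
  (∀ p ∈ domA₂ d T ∪ domB₂ d T ∪ domC₂ d T,
    P.P12 p.1 p.2 = Q.P12 p.1 p.2 ∧ P.P22hat p.1 p.2 = Q.P22hat p.1 p.2) ∧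
  (∀ p ∈ domA₃ d T ∪ domB₃ d T ∪ domC₃ d T, P.P22 p.1 p.2.1 p.2.2 = Q.P22 p.1 p.2.1 p.2.2)

end RiccatiKernel

/-! Write `c = (b / σ) ^ 2`. Kernels proportional to `P₁₁`, namely `P₁₂ = b P₁₁`, `P₂₂ = b² P₁₁` and
`P̂₂₂ (t, s) = σ² P₁₁ (t + s + d)`, cut off above the jump surface, reduce the whole system to one
scalar equation. For `q = 1 / P₁₁` it is the linear delay equation `q' t = - c * q (t + d)` for `t <
T - d`, with `q = 1` on `[T - d, T]`. Its solution is the polynomial spline `delayExp`, which is at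
least `1`, so existence follows (`isSolution_ofFun`, `isSolution_delayExp`).

Uniqueness amounts to showing that every solution has this form. For `t > T - d`, `P̂₂₂ (t, 0) = 0`,
so the convention on division kills all right-hand sides and the kernels are read off along
characteristics. For `t ≤ T - d`, the defects `X = P₁₂ - b P₁₁` and `Y = P₂₂ - b P₁₂` solve a linear
homogeneous transport system with bounded coefficients. Their data vanish, except that `Y = b X` at
`s = -d`. A Gronwall iteration in an exponentially weighted sup norm gives `X = Y = 0`
(`kernels_of_le`). Then `1 / P₁₁` satisfies the delay equation, and the method of steps identifies
it with `q` (`P11_eq`).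

For the lower bound, comparison with the binomial expansion gives `q 0 ≤ (1 + c d) ^ N`, where `N`
is the index (`delayExp_zero_le`), while `a_N (1 + c d) ^ N ≤ 1` by induction
(`riccatiSeq_mul_pow_le_one`). -/

open Set Filter MeasureTheory Topology

/-! ### Absolutely continuous functions -/

theorem AbsolutelyContinuousOnInterval.comp_lipschitzOnWith {f g : ℝ → ℝ} {a b : ℝ} {K : NNReal}
    {s : Set ℝ} (hg : LipschitzOnWith K g s) (hf : AbsolutelyContinuousOnInterval f a b)
    (hs : MapsTo f (uIcc a b) s) : AbsolutelyContinuousOnInterval (fun x => g (f x)) a b := by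
  refine squeeze_zero' ?_ ?_ (by simpa using Tendsto.const_mul (K : ℝ) hf)
  · exact Eventually.of_forall fun _ => Finset.sum_nonneg fun _ _ => dist_nonneg
  · rw [eventually_inf_principal]
    filter_upwards with E hE
    rw [Finset.mul_sum]
    exact Finset.sum_le_sum fun i hi =>
      hg.dist_le_mul _ (hs (hE.1 i hi).1) _ (hs (hE.1 i hi).2)

theorem AbsolutelyContinuousOnInterval.fun_inv_of_le {f : ℝ → ℝ} {a b m : ℝ} (hm : 0 < m)
    (hf : AbsolutelyContinuousOnInterval f a b) (hfm : ∀ x ∈ uIcc a b, m ≤ f x) :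
    AbsolutelyContinuousOnInterval (fun x => (f x)⁻¹) a b := by
  have hg : LipschitzOnWith (Real.toNNReal (m⁻¹ ^ 2)) (fun x : ℝ => x⁻¹) (Ici m) := by
    refine LipschitzOnWith.of_dist_le_mul fun x hx y hy => ?_
    have hx' : m ≤ x := hx
    have hy' : m ≤ y := hy
    have hx0 : 0 < x := hm.trans_le hx'
    have hy0 : 0 < y := hm.trans_le hy'
    rw [Real.coe_toNNReal _ (by positivity), Real.dist_eq, Real.dist_eq,
      inv_sub_inv hx0.ne' hy0.ne', abs_div, abs_of_pos (mul_pos hx0 hy0), abs_sub_comm,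
      div_eq_mul_inv, mul_comm, mul_inv, sq]
    gcongr
  exact hf.comp_lipschitzOnWith hg hfm

theorem AbsolutelyContinuousOnInterval.mono_Icc {f : ℝ → ℝ} {a b x y : ℝ}
    (hf : AbsolutelyContinuousOnInterval f a b) (hx : a ≤ x) (hxy : x ≤ y) (hy : y ≤ b) :
    AbsolutelyContinuousOnInterval f x y := by
  refine hf.mono ?_
  rw [uIcc_of_le hxy, uIcc_of_le (hx.trans (hxy.trans hy))]
  exact Icc_subset_Icc hx hy

theorem ae_forall_mem_Icc_of_Ioo {p : ℝ → Prop} {x y : ℝ} (h : ∀ᵐ t : ℝ, t ∈ Ioo x y → p t) :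
    ∀ᵐ t : ℝ, t ∈ Icc x y → p t := by
  have hx : ∀ᵐ t : ℝ, t ≠ x := by simp [ae_iff]
  have hy : ∀ᵐ t : ℝ, t ≠ y := by simp [ae_iff]
  filter_upwards [h, hx, hy] with t ht h1 h2 h3
  exact ht ⟨lt_of_le_of_ne h3.1 (Ne.symm h1), lt_of_le_of_ne h3.2 h2⟩

/-- An absolutely continuous function whose derivative vanishes almost everywhere is constant. -/
theorem AbsolutelyContinuousOnInterval.eq_of_ae_hasDerivAt_zero {f : ℝ → ℝ} {a b x y : ℝ}
    (hf : AbsolutelyContinuousOnInterval f a b) (hx : a ≤ x) (hxy : x ≤ y) (hy : y ≤ b)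
    (h : ∀ᵐ t : ℝ, t ∈ Ioo x y → HasDerivAt f 0 t) : f x = f y := by
  obtain ⟨C, hC⟩ := (hf.mono_Icc hx hxy hy).const_of_ae_hasDerivAt_zero
    (by rw [uIcc_of_le hxy]; exact ae_forall_mem_Icc_of_Ioo h)
  rw [hC x left_mem_uIcc, hC y right_mem_uIcc]

/-- The increment of an absolutely continuous function with an exponential bound on the
derivative. -/
theorem AbsolutelyContinuousOnInterval.abs_sub_le_of_ae_exp {f : ℝ → ℝ} {a b x y L l : ℝ}
    (hL : 0 ≤ L) (hl : 0 < l)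
    (hf : AbsolutelyContinuousOnInterval f a b) (hx : a ≤ x) (hxy : x ≤ y) (hy : y ≤ b)
    (h : ∀ᵐ t : ℝ, t ∈ Ioo x y → |deriv f t| ≤ L * Real.exp (-l * t)) :
    |f y - f x| ≤ L / l * Real.exp (-l * x) := by
  have hd : ∀ t : ℝ, HasDerivAt (fun t => -(L / l) * Real.exp (-l * t))
      (L * Real.exp (-l * t)) t := by
    intro t
    have h1 : HasDerivAt (fun t : ℝ => -l * t) (-l) t := by
      simpa using (hasDerivAt_id t).const_mul (-l)
    convert! h1.exp.const_mul (-(L / l)) using 1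
    field_simp
  have hc : Continuous fun t : ℝ => L * Real.exp (-l * t) := by fun_prop
  rw [← (hf.mono_Icc hx hxy hy).integral_deriv_eq_sub, ← Real.norm_eq_abs]
  refine (intervalIntegral.norm_integral_le_of_norm_le hxy ?_ (hc.intervalIntegrable x y)).trans ?_
  · filter_upwards [ae_forall_mem_Icc_of_Ioo h] with t ht h1
    exact ht (Ioc_subset_Icc_self h1)
  · rw [intervalIntegral.integral_eq_sub_of_hasDerivAt (fun t _ => hd t)
      (hc.intervalIntegrable x y)]
    have : 0 ≤ L / l * Real.exp (-l * y) := by positivity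
    linarith

/-! ### The delayed exponential -/

/-- The solution of `q' t = - c * q (t + d)` for `t < T - d` with `q = 1` on `[T - d, T]`, as long
as `T - t` is at most `(M + 1) * d`. -/
noncomputable def delayExp (c d T : ℝ) (M : ℕ) (t : ℝ) : ℝ :=
  ∑ k ∈ Finset.range (M + 1), c ^ k * max (T - t - k * d) 0 ^ k / k.factorial

theorem absolutelyContinuousOnInterval_delayExp (c d T : ℝ) (M : ℕ) (x y : ℝ) :
    AbsolutelyContinuousOnInterval (delayExp c d T M) x y := by
  have hcst : ∀ r : ℝ, AbsolutelyContinuousOnInterval (fun _ : ℝ => r) x y := fun r =>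
    (LipschitzWith.const r).lipschitzOnWith.absolutelyContinuousOnInterval
  have hmax : ∀ k : ℕ, AbsolutelyContinuousOnInterval (fun t => max (T - t - k * d) 0) x y := by
    intro k
    have : LipschitzWith 1 (fun t => max (T - t - k * d) 0) := by
      refine LipschitzWith.max_const (LipschitzWith.of_dist_le_mul fun s t => ?_) 0
      rw [Real.dist_eq, Real.dist_eq, abs_sub_comm]
      apply le_of_eq
      simp only [NNReal.coe_one, one_mul]
      congr 1
      ring
    exact this.lipschitzOnWith.absolutelyContinuousOnInterval
  have hpow : ∀ k j : ℕ,
      AbsolutelyContinuousOnInterval (fun t => max (T - t - k * d) 0 ^ j) x y := by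
    intro k j
    induction j with
    | zero => simpa using hcst 1
    | succ j ih => simpa only [pow_succ] using ih.fun_mul (hmax k)
  have hsum : ∀ n : ℕ, AbsolutelyContinuousOnInterval (fun t => ∑ k ∈ Finset.range n,
      c ^ k * max (T - t - k * d) 0 ^ k / k.factorial) x y := by
    intro n
    induction n with
    | zero => simpa using hcst 0
    | succ n ih =>
      simp only [Finset.sum_range_succ]
      refine ih.fun_add ?_
      convert! (hpow n n).const_mul (c ^ n / n.factorial) using 2
      ring
  exact hsum (M + 1)

theorem continuous_delayExp (c d T : ℝ) (M : ℕ) : Continuous (delayExp c d T M) := by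
  unfold delayExp
  fun_prop

theorem one_le_delayExp {c d T : ℝ} (hc : 0 ≤ c) (M : ℕ) (t : ℝ) : 1 ≤ delayExp c d T M t := by
  unfold delayExp
  rw [Finset.sum_range_succ']
  have : 0 ≤ ∑ k ∈ Finset.range M,
      c ^ (k + 1) * max (T - t - (k + 1 : ℕ) * d) 0 ^ (k + 1) / (k + 1).factorial := by
    positivity
  simpa using this

theorem delayExp_of_le {c d T : ℝ} (hd : 0 ≤ d) (M : ℕ) {t : ℝ} (ht : T - d ≤ t) :
    delayExp c d T M t = 1 := by
  unfold delayExp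
  rw [Finset.sum_range_succ', Finset.sum_eq_zero]
  · simp
  · intro k _
    have hk : (0 : ℝ) ≤ k * d := by positivity
    rw [max_eq_right (by push_cast; linarith)]
    simp

theorem hasDerivAt_delayExp_of_gt {c d T : ℝ} (hd : 0 ≤ d) (M : ℕ) {t : ℝ} (ht : T - d < t) :
    HasDerivAt (delayExp c d T M) 0 t := by
  refine (hasDerivAt_const t (1 : ℝ)).congr_of_eventuallyEq ?_
  filter_upwards [lt_mem_nhds ht] with s hs
  exact delayExp_of_le hd M hs.le

/-- Term `k + 1` at `t` differentiates to `-c` times term `k` at `t + d`. The unmatched term `M` at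
`t + d` vanishes because `T ≤ t + (M + 1) * d`. Excluding the grid `T - k * d`, a null set, avoids
the points where the maxima switch. -/
theorem hasDerivAt_delayExp_of_lt {c d T : ℝ} {M : ℕ} (hM : M ≠ 0) {t : ℝ}
    (ht : t < T - d) (htM : T ≤ t + (M + 1) * d) (hne : ∀ k : ℕ, t ≠ T - k * d) :
    HasDerivAt (delayExp c d T M) (-c * delayExp c d T M (t + d)) t := by
  have hterm : ∀ j : ℕ, HasDerivAt
      (fun t => c ^ (j + 1) * max (T - t - (j + 1 : ℕ) * d) 0 ^ (j + 1) / (j + 1).factorial)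
      (-c * (c ^ j * max (T - (t + d) - j * d) 0 ^ j / j.factorial)) t := by
    intro j
    have hlin : HasDerivAt (fun t => T - t - (j + 1 : ℕ) * d) (-1) t := by
      simpa using ((hasDerivAt_id t).const_sub T).sub_const ((j + 1 : ℕ) * d)
    have hx : T - (t + d) - j * d = T - t - (j + 1 : ℕ) * d := by push_cast; ring
    rw [hx]
    have hfac : ((j + 1).factorial : ℝ) = (j + 1) * j.factorial := by
      rw [Nat.factorial_succ]; push_cast; ring
    have hj0 : (j.factorial : ℝ) ≠ 0 := by positivity
    have hj1 : (j + 1 : ℝ) ≠ 0 := by positivity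
    rcases lt_trichotomy (T - t - (j + 1 : ℕ) * d) 0 with h | h | h
    -- For `j = 0` the claimed derivative would contain `0 ^ 0 = 1`; this case is ruled out by `t <
    -- T - d`.
    · have hj : j ≠ 0 := by
        rintro rfl
        simp at h
        linarith
      rw [max_eq_right h.le, zero_pow hj]
      simp only [mul_zero, zero_div]
      refine (hasDerivAt_const t (0 : ℝ)).congr_of_eventuallyEq ?_
      filter_upwards [hlin.continuousAt.eventually (gt_mem_nhds h)] with s hs
      rw [max_eq_right hs.le]
      simp
    · exact absurd (by linarith) (hne (j + 1))
    · rw [max_eq_left h.le]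
      have h1 : HasDerivAt
          (fun t => c ^ (j + 1) * (T - t - (j + 1 : ℕ) * d) ^ (j + 1) / (j + 1).factorial)
          (-c * (c ^ j * (T - t - (j + 1 : ℕ) * d) ^ j / j.factorial)) t := by
        convert! ((hlin.pow (j + 1)).const_mul (c ^ (j + 1))).div_const ((j + 1).factorial : ℝ)
          using 1
        rw [hfac]
        simp only [Nat.add_sub_cancel]
        push_cast
        field_simp
        ring
      refine h1.congr_of_eventuallyEq ?_
      filter_upwards [hlin.continuousAt.eventually (lt_mem_nhds h)] with s hs
      rw [max_eq_left hs.le]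
  have hq : delayExp c d T M = fun t => ∑ k ∈ Finset.range M,
      c ^ (k + 1) * max (T - t - (k + 1 : ℕ) * d) 0 ^ (k + 1) / (k + 1).factorial + 1 := by
    funext t
    unfold delayExp
    rw [Finset.sum_range_succ']
    simp
  have hlast : delayExp c d T M (t + d) = ∑ j ∈ Finset.range M,
      c ^ j * max (T - (t + d) - j * d) 0 ^ j / j.factorial := by
    unfold delayExp
    rw [Finset.sum_range_succ, max_eq_right (by linarith), zero_pow hM]
    simp
  rw [hlast, Finset.mul_sum, hq]
  exact (HasDerivAt.fun_sum fun j _ => hterm j).add_const 1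

/-- Termwise comparison with the binomial theorem: `T - k d ≤ (M - k) d`, and `(M - k) ^ k` is at
most the falling factorial `M (M - 1) ⋯ (M - k + 1) = k! * M.choose k`. -/
theorem delayExp_zero_le {c d T : ℝ} (hc : 0 ≤ c) (hd : 0 ≤ d) {M : ℕ} (hT : T ≤ M * d) :
    delayExp c d T M 0 ≤ (1 + c * d) ^ M := by
  rw [add_comm, add_pow]
  refine Finset.sum_le_sum fun k hk => ?_
  have hkM : k ≤ M := by simpa [Nat.lt_succ_iff] using hk
  have h1 : max (T - 0 - k * d) 0 ≤ (M - k : ℕ) * d := by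
    refine max_le ?_ (by positivity)
    rw [Nat.cast_sub hkM]
    linarith
  have h2 : ((M - k : ℕ) : ℝ) ^ k ≤ (M.choose k : ℝ) * k.factorial := by
    have h3 : (M - k) ^ k ≤ M.choose k * k.factorial := by
      rw [mul_comm, ← Nat.descFactorial_eq_factorial_mul_choose]
      exact (Nat.pow_le_pow_left (by omega) k).trans (Nat.pow_sub_le_descFactorial M k)
    exact_mod_cast h3
  rw [div_le_iff₀ (by positivity)]
  calc c ^ k * max (T - 0 - k * d) 0 ^ k ≤ c ^ k * ((M - k : ℕ) * d) ^ k := by gcongr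
    _ = (c * d) ^ k * ((M - k : ℕ) : ℝ) ^ k := by rw [mul_pow, mul_pow]; ring
    _ ≤ (c * d) ^ k * ((M.choose k : ℝ) * k.factorial) := by gcongr
    _ = _ := by ring

/-- The term `k = 1` is already `c (T - d) > 0`. -/
theorem one_lt_delayExp_zero {c d T : ℝ} (hc : 0 < c) (hT : d < T) {M : ℕ} (hM : M ≠ 0) :
    1 < delayExp c d T M 0 := by
  unfold delayExp
  obtain ⟨n, rfl⟩ := Nat.exists_eq_succ_of_ne_zero hM
  rw [Finset.sum_range_succ', Finset.sum_range_succ']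
  have h1 : 0 ≤ ∑ k ∈ Finset.range n, c ^ (k + 1 + 1) *
      max (T - 0 - (k + 1 + 1 : ℕ) * d) 0 ^ (k + 1 + 1) / (k + 1 + 1).factorial := by
    positivity
  have h2 : 0 < c * max (T - d) 0 := mul_pos hc (lt_max_of_lt_left (by linarith))
  push_cast at h1
  simp only [sub_zero] at h1 ⊢
  simp
  linarith

/-! ### The sequence -/

theorem exists_mem_of_one_le_riccatiIndex {d b σ : ℝ} (hN : 1 ≤ riccatiIndex d b σ) :
    {n : ℕ | 1 ≤ n ∧ 0 < riccatiSeq d b σ n ∧ riccatiSeq d b σ (n + 1) ≤ 0}.Nonempty :=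
  Nat.nonempty_of_pos_sInf hN

/-- For `b = 0` the sequence is constant, so the set defining the index is empty and its `sInf` is
`0`. -/
theorem ne_zero_of_one_le_riccatiIndex {d b σ : ℝ} (hN : 1 ≤ riccatiIndex d b σ) : b ≠ 0 := by
  rintro rfl
  obtain ⟨n, -, h1, h2⟩ := exists_mem_of_one_le_riccatiIndex hN
  simp [riccatiSeq] at h2
  linarith

/-- A first sign change at some `n ≥ 1` below the index would contradict minimality. The set starts
at `n = 1`, so positivity of `a 1` has to be supplied. -/
theorem riccatiSeq_pos_of_le_riccatiIndex {d b σ : ℝ} (ha : 0 < riccatiSeq d b σ 1) {n : ℕ}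
    (hn : n ≤ riccatiIndex d b σ) : 0 < riccatiSeq d b σ n := by
  induction n with
  | zero => simp [riccatiSeq]
  | succ n ih =>
    rcases Nat.eq_zero_or_pos n with rfl | h0
    · exact ha
    · by_contra! hle
      have hlt : n < sInf {n : ℕ | 1 ≤ n ∧ 0 < riccatiSeq d b σ n ∧
          riccatiSeq d b σ (n + 1) ≤ 0} := hn
      exact Nat.notMem_of_lt_sInf hlt ⟨h0, ih (by omega), hle⟩

/-- Since `0 < a ≤ 1`, `d / a ≥ d a`; hence the next term is at most `a (1 - c d)`, and `(1 - c d)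
(1 + c d) ≤ 1`. -/
theorem riccatiSeq_mul_pow_le_one {d b σ : ℝ} (hd : 0 ≤ d) {n : ℕ}
    (hpos : ∀ k ≤ n, 0 < riccatiSeq d b σ k) :
    riccatiSeq d b σ n * (1 + (b / σ) ^ 2 * d) ^ n ≤ 1 := by
  induction n with
  | zero => simp [riccatiSeq]
  | succ n ih =>
    have h := ih fun k hk => hpos k (by omega)
    have ha := hpos n (by omega)
    set a := riccatiSeq d b σ n with hadef
    set c := (b / σ) ^ 2 with hc
    have hc0 : 0 ≤ c := sq_nonneg _
    have hcd : 0 ≤ c * d := by positivity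
    have hp : 1 ≤ (1 + c * d) ^ n := one_le_pow₀ (by linarith)
    have ha1 : a ≤ 1 := by nlinarith
    have hstep : riccatiSeq d b σ (n + 1) * (1 + c * d) ≤ a := by
      have e : riccatiSeq d b σ (n + 1) = a - d / a * c := rfl
      have h1 : d * a ≤ d / a := by
        rw [le_div_iff₀ ha]
        nlinarith [mul_nonneg hd (sub_nonneg.2 ha1), mul_nonneg (mul_nonneg hd ha.le) (sub_nonneg.2 ha1)]
      have h2 : riccatiSeq d b σ (n + 1) ≤ a * (1 - c * d) := by
        rw [e]
        nlinarith
      calc riccatiSeq d b σ (n + 1) * (1 + c * d) ≤ a * (1 - c * d) * (1 + c * d) := by gcongr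
        _ = a - a * (c * d) ^ 2 := by ring
        _ ≤ a := by nlinarith [mul_nonneg ha.le (sq_nonneg (c * d))]
    calc riccatiSeq d b σ (n + 1) * (1 + c * d) ^ (n + 1)
        = riccatiSeq d b σ (n + 1) * (1 + c * d) * (1 + c * d) ^ n := by ring
      _ ≤ a * (1 + c * d) ^ n := by gcongr
      _ ≤ 1 := h

namespace RiccatiKernel

/-! ### The explicit solution -/

/-- The kernel with `P₁₁ = p`, `P₁₂ = b p`, `P₂₂ = b² p` and `P̂₂₂ (t, s) = σ² p (t + s + d)`, cut
off above the jump surface. -/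
noncomputable def ofFun (d b σ T : ℝ) (p : ℝ → ℝ) : RiccatiKernel where
  P11 := p
  P12 t s := if t + s ≤ T - d then b * p t else 0
  P22hat t s := if t + s ≤ T - d then σ ^ 2 * p (t + s + d) else 0
  P22 t s r := if t + max s r ≤ T - d then b ^ 2 * p t else 0

theorem absolutelyContinuousOnInterval_const (r x y : ℝ) :
    AbsolutelyContinuousOnInterval (fun _ : ℝ => r) x y :=
  (LipschitzWith.const r).lipschitzOnWith.absolutelyContinuousOnInterval

theorem acOn₂_const (r : ℝ) (S : Set (ℝ × ℝ)) : ACOn₂ (fun _ _ => r) S :=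
  ⟨continuousOn_const, fun _ x y _ _ => absolutelyContinuousOnInterval_const r x y,
    fun _ x y _ _ => absolutelyContinuousOnInterval_const r x y⟩

theorem acOn₃_const (r : ℝ) (S : Set (ℝ × ℝ × ℝ)) : ACOn₃ (fun _ _ _ => r) S :=
  ⟨continuousOn_const, fun _ _ x y _ _ => absolutelyContinuousOnInterval_const r x y,
    fun _ _ x y _ _ => absolutelyContinuousOnInterval_const r x y,
    fun _ _ x y _ _ => absolutelyContinuousOnInterval_const r x y⟩

theorem acOn₂_fst {p : ℝ → ℝ} (hp : Continuous p)
    (hac : ∀ x y, AbsolutelyContinuousOnInterval p x y) (S : Set (ℝ × ℝ)) :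
    ACOn₂ (fun t _ => p t) S :=
  ⟨(hp.comp continuous_fst).continuousOn, fun _ x y _ _ => hac x y,
    fun _ x y _ _ => absolutelyContinuousOnInterval_const _ x y⟩

theorem acOn₃_fst {p : ℝ → ℝ} (hp : Continuous p)
    (hac : ∀ x y, AbsolutelyContinuousOnInterval p x y) (S : Set (ℝ × ℝ × ℝ)) :
    ACOn₃ (fun t _ _ => p t) S :=
  ⟨(hp.comp continuous_fst).continuousOn, fun _ _ x y _ _ => hac x y,
    fun _ _ x y _ _ => absolutelyContinuousOnInterval_const _ x y,
    fun _ _ x y _ _ => absolutelyContinuousOnInterval_const _ x y⟩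

theorem absolutelyContinuousOnInterval_comp_add_right {p : ℝ → ℝ} {c x y : ℝ}
    (hp : AbsolutelyContinuousOnInterval p (x + c) (y + c)) :
    AbsolutelyContinuousOnInterval (fun t => p (t + c)) x y := by
  rw [absolutelyContinuousOnInterval_iff] at hp ⊢
  intro ε hε
  obtain ⟨δ, hδ, h⟩ := hp ε hε
  refine ⟨δ, hδ, fun E hE hlen => ?_⟩
  refine h (E.1, fun i => ((E.2 i).1 + c, (E.2 i).2 + c)) ⟨fun i hi => ?_, ?_⟩ (by simpa using hlen)
  · have := hE.1 i hi
    simp only [mem_uIcc] at this ⊢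
    grind
  · intro i hi j hj hij
    have := hE.2 hi hj hij
    rw [Function.onFun, Set.disjoint_left] at this ⊢
    intro z hz hz'
    refine this (a := z - c) ?_ ?_ <;> simp only [mem_uIoc] at * <;> grind

theorem acOn₂_add {p : ℝ → ℝ} (hp : Continuous p)
    (hac : ∀ x y, AbsolutelyContinuousOnInterval p x y) (c : ℝ) (S : Set (ℝ × ℝ)) :
    ACOn₂ (fun t s => p (t + s + c)) S := by
  refine ⟨Continuous.continuousOn (by fun_prop), fun s x y _ _ => ?_, fun t x y _ _ => ?_⟩
  · simp only [add_assoc]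
    exact absolutelyContinuousOnInterval_comp_add_right (hac _ _)
  · have : (fun s => p (t + s + c)) = fun s => p (s + (t + c)) := by
      funext s; congr 1; ring
    rw [this]
    exact absolutelyContinuousOnInterval_comp_add_right (hac _ _)

/-- The equations for `P₁₁`, `P₁₂`, `P₂₂` are the scalar equation for `p` times `1`, `b`, `b²`. The
cutoffs depend on `t + s` and `t + max s r`, which are constant along characteristics, so they never
switch on an admissible line. -/
theorem isSolution_ofFun {d b σ T : ℝ} (hσ : σ ≠ 0)
    {p : ℝ → ℝ} (hac : ∀ x y, AbsolutelyContinuousOnInterval p x y) (hcont : Continuous p)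
    (hpos : ∀ t, 0 < p t) (hone : p T = 1)
    (hgt : ∀ t, T - d < t → HasDerivAt p 0 t)
    (hlt : ∀ᵐ t : ℝ, t ∈ Ioo 0 T → t < T - d →
      HasDerivAt p ((b * p t) ^ 2 / (σ ^ 2 * p (t + d))) t) :
    (ofFun d b σ T p).IsSolution d b σ T := by
  have hne : ∀ a : ℝ, ∀ᵐ t : ℝ, t ≠ a := fun a => by simp [ae_iff]
  -- Both time regimes in one formula: past `T - d` the quotient is `0 / 0 = 0`.
  have heq : ∀ᵐ t : ℝ, t ∈ Ioo 0 T → HasDerivAt p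
      ((if t ≤ T - d then b * p t else 0) ^ 2 / (if t ≤ T - d then σ ^ 2 * p (t + d) else 0)) t := by
    filter_upwards [hlt, hne (T - d)] with t ht h0 h1
    rcases lt_or_gt_of_ne h0 with h | h
    · rw [if_pos h.le, if_pos h.le]
      exact ht h1 h
    · rw [if_neg (not_le.2 h)]
      simpa using hgt t h
  have hp2 : ∀ r x y, AbsolutelyContinuousOnInterval (fun t => r * p t) x y := fun r x y =>
    (hac x y).const_mul r
  refine
    { ac11 := hac 0 T
      ac12 := ?_
      ac22hat := ?_
      ac22 := ?_
      eq11 := by simpa [ofFun] using heq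
      eq12 := ?_
      eq22hat := ?_
      eq22 := ?_
      bdry12 := fun t ht => if_pos (by linarith [ht.2])
      bdry22hat := fun t ht => by
        simp only [ofFun]
        rw [if_pos (by linarith [ht.2]), neg_add_cancel_right]
      bdry22_right := fun t ht => Eventually.of_forall fun s hs => by
        simp only [ofFun]
        rw [max_eq_left hs.1]
        split_ifs <;> ring
      bdry22_left := fun t ht => Eventually.of_forall fun s hs => by
        simp only [ofFun]
        rw [max_eq_right hs.1]
        split_ifs <;> ring
      final11 := hone
      final12 := ?_
      final22hat := ?_
      final22 := ?_
      pos22hat := fun t ht h s hs => by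
        simp only [ofFun]
        rw [if_pos (by linarith [hs.2])]
        have := hpos (t + s + d)
        positivity }
  · rintro S (rfl | rfl | rfl)
    · refine ⟨_, acOn₂_fst (hcont.const_mul b) (hp2 b) _, fun q hq => if_pos ?_⟩
      linarith [hq.2.1, hq.2.2.2]
    · exact ⟨_, acOn₂_fst (hcont.const_mul b) (hp2 b) _, fun q hq => if_pos hq.2.2.2.le⟩
    · exact ⟨_, acOn₂_const 0 _, fun q hq => if_neg (not_le.2 hq.2.2.2)⟩
  · rintro S (rfl | rfl | rfl)
    · refine ⟨_, acOn₂_add (hcont.const_mul (σ ^ 2)) (hp2 _) d _, fun q hq => if_pos ?_⟩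
      linarith [hq.2.1, hq.2.2.2]
    · exact ⟨_, acOn₂_add (hcont.const_mul (σ ^ 2)) (hp2 _) d _, fun q hq => if_pos hq.2.2.2.le⟩
    · exact ⟨_, acOn₂_const 0 _, fun q hq => if_neg (not_le.2 hq.2.2.2)⟩
  · rintro S (rfl | rfl | rfl)
    · refine ⟨_, acOn₃_fst (hcont.const_mul (b ^ 2)) (hp2 _) _, fun q hq => if_pos ?_⟩
      have := max_le hq.2.2.1.2 hq.2.2.2.2
      linarith [hq.2.1]
    · exact ⟨_, acOn₃_fst (hcont.const_mul (b ^ 2)) (hp2 _) _, fun q hq => if_pos hq.2.2.2.2.le⟩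
    · exact ⟨_, acOn₃_const 0 _, fun q hq => if_neg (not_le.2 hq.2.2.2.2)⟩
  · intro u hu hne
    simp only [ofFun, add_sub_cancel, add_zero]
    rcases lt_or_gt_of_ne hne with h | h
    · simp only [if_pos h.le]
      refine ⟨hp2 _ _ _, ?_⟩
      filter_upwards [heq] with t ht h1
      have h1' := h1
      simp only [mem_Ioo, max_lt_iff, lt_min_iff] at h1'
      convert! (ht ⟨h1'.1.1, h1'.2.1⟩).const_mul b using 1
      rw [max_eq_right (by linarith), add_zero]
      split_ifs <;> ring
    · simp only [if_neg (not_le.2 h)]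
      refine ⟨absolutelyContinuousOnInterval_const _ _ _, Eventually.of_forall fun t h1 => ?_⟩
      simp only [mem_Ioo, max_lt_iff, lt_min_iff] at h1
      rw [if_neg (by linarith)]
      simpa using hasDerivAt_const t (0 : ℝ)
  · intro u hu hne
    simp only [ofFun, add_sub_cancel]
    exact ⟨absolutelyContinuousOnInterval_const _ _ _,
      Eventually.of_forall fun t h1 => hasDerivAt_const t _⟩
  · intro u v hu hne
    have hmax : ∀ t : ℝ, t + max (u - t) (v - t) = max u v := fun t => by
      rw [max_sub_sub_right]; ring
    simp only [ofFun, hmax, add_zero]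
    rcases lt_or_gt_of_ne hne with h | h
    · simp only [if_pos h.le]
      refine ⟨hp2 _ _ _, ?_⟩
      filter_upwards [heq] with t ht h1
      have h1' := h1
      simp only [mem_Ioo, max_lt_iff, lt_min_iff] at h1'
      convert! (ht ⟨h1'.1.1, h1'.2.1⟩).const_mul (b ^ 2) using 1
      rw [max_eq_right (by linarith), max_eq_left (by linarith), add_zero]
      split_ifs <;> ring
    · simp only [if_neg (not_le.2 h)]
      refine ⟨absolutelyContinuousOnInterval_const _ _ _, Eventually.of_forall fun t h1 => ?_⟩
      have : max u v < t := (le_max_right _ _).trans_lt h1.1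
      rw [if_neg (c := t ≤ T - d) (by linarith)]
      simpa using hasDerivAt_const t (0 : ℝ)
  -- At `t = T` only `s = -d` lies on the jump surface, which is why the final conditions hold
  -- almost everywhere.
  · filter_upwards [hne (-d)] with s hs h
    exact if_neg (not_le.2 (by linarith [lt_of_le_of_ne h.1 (Ne.symm hs)]))
  · filter_upwards [hne (-d)] with s hs h
    exact if_neg (not_le.2 (by linarith [lt_of_le_of_ne h.1 (Ne.symm hs)]))
  · have : ∀ᵐ q : ℝ × ℝ, q.1 ≠ -d :=
      Measure.quasiMeasurePreserving_fst.ae (hne (-d))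
    filter_upwards [this] with q hs h _
    have := lt_of_le_of_ne h.1 (Ne.symm hs)
    exact if_neg (not_le.2 (by linarith [le_max_left q.1 q.2]))

/-- The explicit solution built from the delayed exponential. -/
theorem isSolution_delayExp {d b σ T : ℝ} (hd : 0 < d) (hσ : σ ≠ 0) {M : ℕ}
    (hM : M ≠ 0) (hTM : T ≤ M * d) :
    (ofFun d b σ T fun t => (delayExp ((b / σ) ^ 2) d T M t)⁻¹).IsSolution d b σ T := by
  set q := delayExp ((b / σ) ^ 2) d T M with hq
  have hq1 : ∀ t, 1 ≤ q t := one_le_delayExp (sq_nonneg _) M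
  have hq0 : ∀ t, q t ≠ 0 := fun t => (zero_lt_one.trans_le (hq1 t)).ne'
  refine isSolution_ofFun hσ (fun x y => ?_) ?_ (fun t => ?_) ?_ (fun t ht => ?_) ?_
  · exact (absolutelyContinuousOnInterval_delayExp _ d T M x y).fun_inv_of_le zero_lt_one
      fun t _ => hq1 t
  · exact (continuous_delayExp _ d T M).inv₀ hq0
  · exact inv_pos.2 (zero_lt_one.trans_le (hq1 t))
  · rw [hq, delayExp_of_le hd.le M (by linarith), inv_one]
  · simpa using (hasDerivAt_delayExp_of_gt (c := (b / σ) ^ 2) hd.le M ht).fun_inv (hq0 t)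
  · have hne : ∀ᵐ t : ℝ, ∀ k : ℕ, t ≠ T - k * d :=
      ae_all_iff.2 fun k => by simp [ae_iff]
    filter_upwards [hne] with t ht h0 h1
    -- `(1 / q)' = c q (t + d) / q t ^ 2`, which is the required quotient with `p = 1 / q`.
    convert! (hasDerivAt_delayExp_of_lt (c := (b / σ) ^ 2) hM h1 (by nlinarith [h0.1]) ht).fun_inv
      (hq0 t) using 1
    rw [← hq]
    have h1 := hq0 t
    have h2 := hq0 (t + d)
    field_simp

end RiccatiKernel

/-! ### Continuous functions known almost everywhere -/

/-- Turns almost-everywhere boundary and final data into pointwise values. Continuity is asked on a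
half-open interval because the other end may lie on the jump surface. -/
theorem eq_of_ae_eq_Ioo_of_continuousOn_Ioc {f : ℝ → ℝ} {a x c : ℝ} (hax : a < x)
    (hf : ContinuousOn f (Ioc a x)) (h : ∀ᵐ s : ℝ, s ∈ Ioo a x → f s = c) : f x = c := by
  have h' : f =ᵐ[volume.restrict (Ioc a x)] fun _ => c := by
    rw [EventuallyEq, ae_restrict_iff' measurableSet_Ioc]
    filter_upwards [ae_forall_mem_Icc_of_Ioo h] with s hs hs'
    exact hs (Ioc_subset_Icc_self hs')
  exact Measure.eqOn_Ioc_of_ae_eq volume h' hf continuousOn_const (right_mem_Ioc.2 hax)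

theorem eq_of_eq_Ioo_of_continuousOn_Ico {f : ℝ → ℝ} {a x c : ℝ} (hax : x < a)
    (hf : ContinuousOn f (Ico x a)) (h : ∀ s ∈ Ioo x a, f s = c) : f x = c := by
  have h' : f =ᵐ[volume.restrict (Ico x a)] fun _ => c := by
    rw [EventuallyEq, ae_restrict_iff' measurableSet_Ico]
    filter_upwards [ae_forall_mem_Icc_of_Ioo (Eventually.of_forall h)] with s hs hs'
    exact hs (Ico_subset_Icc_self hs')
  exact Measure.eqOn_Ico_of_ae_eq volume h' hf continuousOn_const (left_mem_Ico.2 hax)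

theorem eq_of_ae_eq_Ioo_prod_of_continuousOn {f : ℝ × ℝ → ℝ} {a a' x y c : ℝ} (hax : a < x)
    (hay : a' < y) (hf : ContinuousOn f (Ioc a x ×ˢ Ioc a' y))
    (h : ∀ᵐ p : ℝ × ℝ, p ∈ Ioc a x ×ˢ Ioc a' y → f p = c) : f (x, y) = c := by
  have h' : f =ᵐ[volume.restrict (Ioc a x ×ˢ Ioc a' y)] fun _ => c := by
    rw [EventuallyEq, ae_restrict_iff' (measurableSet_Ioc.prod measurableSet_Ioc)]
    exact h
  refine Measure.eqOn_of_ae_eq h' hf continuousOn_const ?_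
    ⟨right_mem_Ioc.2 hax, right_mem_Ioc.2 hay⟩
  rw [interior_prod_eq, closure_prod_eq]
  exact prod_mono (Ioc_subset_closure_interior _ _) (Ioc_subset_closure_interior _ _)

namespace RiccatiKernel

variable {d b σ T : ℝ}

/-! ### Consequences of the transport equations -/

theorem PiecewiseAC₂.continuousOn {f : ℝ → ℝ → ℝ} (hf : PiecewiseAC₂ d T f) {S : Set (ℝ × ℝ)}
    (hS : S ∈ ({domA₂ d T, domB₂ d T, domC₂ d T} : Set (Set (ℝ × ℝ)))) :
    ContinuousOn (fun p : ℝ × ℝ => f p.1 p.2) S := by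
  obtain ⟨g, hg, h⟩ := hf S hS
  exact (hg.1.mono subset_closure).congr h

theorem PiecewiseAC₃.continuousOn {f : ℝ → ℝ → ℝ → ℝ} (hf : PiecewiseAC₃ d T f)
    {S : Set (ℝ × ℝ × ℝ)}
    (hS : S ∈ ({domA₃ d T, domB₃ d T, domC₃ d T} : Set (Set (ℝ × ℝ × ℝ)))) :
    ContinuousOn (fun p : ℝ × ℝ × ℝ => f p.1 p.2.1 p.2.2) S := by
  obtain ⟨g, hg, h⟩ := hf S hS
  exact (hg.1.mono subset_closure).congr h

/-- The source has to vanish only on the open segment travelled, so a start at `t = T - d` is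
allowed later. -/
theorem Transport₂.eq_of_zero {f g : ℝ → ℝ → ℝ} (h : Transport₂ d T f g) {t s τ : ℝ}
    (ht : 0 ≤ t) (hs : s ≤ 0) (hτ : 0 ≤ τ) (htτ : t + τ ≤ T) (hsτ : -d ≤ s - τ)
    (hne : t + s ≠ T - d) (hg : ∀ t', t < t' → t' < t + τ → g t' (t + s - t') = 0) :
    f t s = f (t + τ) (s - τ) := by
  rcases hτ.eq_or_lt with rfl | hτ
  · simp
  have hmax : max 0 (t + s) ≤ t := max_le ht (by linarith)
  have hmin : t + τ ≤ min T (t + s + d) := le_min htτ (by linarith)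
  obtain ⟨hac, hae⟩ := h (t + s) (by linarith) hne
  have := hac.eq_of_ae_hasDerivAt_zero hmax (by linarith) hmin (by
    filter_upwards [hae] with t' ht' hmem
    rw [← hg t' hmem.1 hmem.2]
    exact ht' ⟨hmax.trans_lt hmem.1, hmem.2.trans_le hmin⟩)
  simpa [add_sub_add_left_eq_sub] using this

theorem Transport₃.eq_of_zero {f g : ℝ → ℝ → ℝ → ℝ} (h : Transport₃ d T f g) {t s r τ : ℝ}
    (ht : 0 ≤ t) (hs : s ≤ 0) (hr : r ≤ 0) (hτ : 0 ≤ τ) (htτ : t + τ ≤ T) (hsτ : -d ≤ s - τ)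
    (hrτ : -d ≤ r - τ) (hne : t + max s r ≠ T - d)
    (hg : ∀ t', t < t' → t' < t + τ → g t' (t + s - t') (t + r - t') = 0) :
    f t s r = f (t + τ) (s - τ) (r - τ) := by
  rcases hτ.eq_or_lt with rfl | hτ
  · simp
  have hmax : max 0 (max (t + s) (t + r)) ≤ t :=
    max_le ht (max_le (by linarith) (by linarith))
  have hmin : t + τ ≤ min T (min (t + s) (t + r) + d) := by
    refine le_min htτ ?_
    have : t + τ - d ≤ min (t + s) (t + r) := le_min (by linarith) (by linarith)
    linarith
  obtain ⟨hac, hae⟩ := h (t + s) (t + r) (by linarith) (by rwa [max_add_add_left])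
  have := hac.eq_of_ae_hasDerivAt_zero hmax (by linarith) hmin (by
    filter_upwards [hae] with t' ht' hmem
    rw [← hg t' hmem.1 hmem.2]
    exact ht' ⟨hmax.trans_lt hmem.1, hmem.2.trans_le hmin⟩)
  simpa [add_sub_add_left_eq_sub] using this

/-- A kernel that is transported for `t > T - d` and vanishes at time `T` vanishes above the jump
surface. -/
theorem Transport₂.eq_zero_above {f g : ℝ → ℝ → ℝ} (h : Transport₂ d T f g)
    (hf : PiecewiseAC₂ d T f) (hg : ∀ t s, 0 ≤ t → t ≤ T → T - d < t → g t s = 0)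
    (hfin : ∀ᵐ s : ℝ, s ∈ Icc (-d) 0 → f T s = 0) {t s : ℝ} (ht : t ∈ Icc 0 T)
    (hs : s ∈ Icc (-d) 0) (hts : T - d < t + s) : f t s = 0 := by
  have hlt : T - d < t := by linarith [hs.2]
  have hC := hf.continuousOn (S := domC₂ d T) (by simp)
  have hmem : ∀ s' ∈ Ioc (T - d - t) s, (t, s') ∈ domC₂ d T := fun s' hs' =>
    ⟨ht, hlt, ⟨by simp; linarith [hs'.1, ht.2], hs'.2.trans hs.2⟩, by simp; linarith [hs'.1]⟩
  refine eq_of_ae_eq_Ioo_of_continuousOn_Ioc (a := T - d - t) (by linarith)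
    (hC.comp (f := fun s' => (t, s')) (by fun_prop) hmem) ?_
  -- Translation along the characteristics preserves null sets, which carries the final condition
  -- from time `T` back to time `t`.
  have hfin' := (measurePreserving_add_right volume (t - T)).quasiMeasurePreserving.ae hfin
  filter_upwards [hfin'] with s' h1 hs'
  have h2 : f t s' = f (t + (T - t)) (s' - (T - t)) :=
    h.eq_of_zero ht.1 (by linarith [hs'.2, hs.2]) (by linarith [ht.2]) (by linarith)
      (by linarith [hs'.1]) (by linarith [hs'.1])
      fun t' h3 h4 => hg _ _ (by linarith [ht.1]) (by linarith) (by linarith)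
  rw [h2, add_sub_cancel, show s' - (T - t) = s' + (t - T) by ring]
  exact h1 ⟨by linarith [hs'.1], by linarith [hs'.2, hs.2, ht.2]⟩

/-- A kernel that is transported for `t > T - d` and vanishes at time `T` vanishes above the
surfaces `t + s = T - d` and `t + r = T - d`. -/
theorem Transport₃.eq_zero_above {f g : ℝ → ℝ → ℝ → ℝ} (h : Transport₃ d T f g)
    (hf : PiecewiseAC₃ d T f) (hg : ∀ t s r, 0 ≤ t → t ≤ T → T - d < t → g t s r = 0)
    (hfin : ∀ᵐ p : ℝ × ℝ, p.1 ∈ Icc (-d) 0 → p.2 ∈ Icc (-d) 0 → f T p.1 p.2 = 0) {t s r : ℝ}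
    (ht : t ∈ Icc 0 T) (hs : s ≤ 0) (hr : r ≤ 0) (hts : T - d < t + s)
    (htr : T - d < t + r) : f t s r = 0 := by
  have hC := hf.continuousOn (S := domC₃ d T) (by simp)
  have hmem : ∀ p ∈ Ioc (T - d - t) s ×ˢ Ioc (T - d - t) r, (t, p) ∈ domC₃ d T := fun p hp =>
    ⟨ht, by simp; linarith, ⟨by simp; linarith [hp.1.1, ht.2], hp.1.2.trans hs⟩,
      ⟨by simp; linarith [hp.2.1, ht.2], hp.2.2.trans hr⟩,
      by simp only; linarith [hp.1.1, le_max_left p.1 p.2]⟩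
  refine eq_of_ae_eq_Ioo_prod_of_continuousOn (f := fun p => f t p.1 p.2) (a := T - d - t)
    (a' := T - d - t) (by linarith) (by linarith)
    (hC.comp (f := fun p : ℝ × ℝ => (t, p)) (by fun_prop) hmem) ?_
  have hfin' := (measurePreserving_add_right (volume : Measure (ℝ × ℝ))
    (t - T, t - T)).quasiMeasurePreserving.ae hfin
  filter_upwards [hfin'] with p h1 hp
  obtain ⟨⟨h5, h6⟩, h7, h8⟩ := hp
  have h2 : f t p.1 p.2 = f (t + (T - t)) (p.1 - (T - t)) (p.2 - (T - t)) :=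
    h.eq_of_zero ht.1 (by linarith) (by linarith) (by linarith [ht.2]) (by linarith)
      (by linarith) (by linarith) (by linarith [le_max_left p.1 p.2])
      fun t' h3 h4 => hg _ _ _ (by linarith [ht.1]) (by linarith) (by linarith)
  rw [h2, add_sub_cancel, show p.1 - (T - t) = p.1 + (t - T) by ring,
    show p.2 - (T - t) = p.2 + (t - T) by ring]
  simp only [Prod.fst_add, Prod.snd_add] at h1
  exact h1 ⟨by linarith, by linarith [ht.2]⟩ ⟨by linarith, by linarith [ht.2]⟩

namespace IsSolution

variable {Q : RiccatiKernel}

/-! ### The solution for `t ≥ T - d` -/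

theorem P22hat_above (hQ : Q.IsSolution d b σ T) {t s : ℝ} (ht : t ∈ Icc 0 T)
    (hs : s ∈ Icc (-d) 0) (hts : T - d < t + s) : Q.P22hat t s = 0 :=
  hQ.eq22hat.eq_zero_above hQ.ac22hat (fun _ _ _ _ _ => rfl) hQ.final22hat ht hs hts

/-- With division by zero equal to zero, this removes all quadratic terms for `t > T - d`: there the
equations are pure transport. -/
theorem P22hat_zero (hQ : Q.IsSolution d b σ T) (hd : 0 < d) {t : ℝ} (h0 : 0 ≤ t) (h1 : t ≤ T)
    (ht : T - d < t) : Q.P22hat t 0 = 0 :=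
  hQ.P22hat_above ⟨h0, h1⟩ ⟨by linarith, le_rfl⟩ (by linarith)

theorem P22hat_below (hQ : Q.IsSolution d b σ T) {t s : ℝ} (ht : t ∈ Icc 0 T)
    (hs : s ∈ Icc (-d) 0) (hts : t + s < T - d) : Q.P22hat t s = σ ^ 2 * Q.P11 (t + s + d) := by
  rw [hQ.eq22hat.eq_of_zero (τ := s + d) ht.1 hs.2 (by linarith [hs.1]) (by linarith)
    (by linarith) hts.ne fun _ _ _ => rfl, sub_add_cancel_left,
    hQ.bdry22hat _ ⟨by linarith [hs.1, ht.1], by linarith⟩, add_assoc]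

theorem continuousOn_P11 (hQ : Q.IsSolution d b σ T) (hT : 0 < T) :
    ContinuousOn Q.P11 (Icc 0 T) := by
  simpa [uIcc_of_le hT.le] using hQ.ac11.continuousOn

theorem P11_eq_one (hQ : Q.IsSolution d b σ T) (hd : 0 < d) {t : ℝ} (ht : t ∈ Icc 0 T)
    (htd : T - d ≤ t) : Q.P11 t = 1 := by
  rw [← hQ.final11]
  refine hQ.ac11.eq_of_ae_hasDerivAt_zero ht.1 ht.2 le_rfl ?_
  filter_upwards [hQ.eq11] with t' h1 h2
  have h3 := h1 ⟨by linarith [h2.1, ht.1], h2.2⟩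
  rwa [hQ.P22hat_zero hd (by linarith [h2.1, ht.1]) h2.2.le (by linarith [h2.1]), div_zero] at h3

theorem P12_above (hQ : Q.IsSolution d b σ T) (hd : 0 < d) {t s : ℝ} (ht : t ∈ Icc 0 T)
    (hs : s ∈ Icc (-d) 0) (hts : T - d < t + s) : Q.P12 t s = 0 :=
  hQ.eq12.eq_zero_above hQ.ac12
    (fun t s h0 h1 h2 => by simp only [hQ.P22hat_zero hd h0 h1 h2, div_zero]) hQ.final12 ht hs hts

theorem P12_below (hQ : Q.IsSolution d b σ T) (hd : 0 < d) {t s : ℝ} (ht : t ∈ Icc 0 T)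
    (htd : T - d ≤ t) (hs : s ∈ Icc (-d) 0) (hts : t + s < T - d) : Q.P12 t s = b := by
  have hmem : t + (s + d) ∈ Icc 0 T := ⟨by linarith [hs.1, ht.1], by linarith⟩
  rw [hQ.eq12.eq_of_zero (τ := s + d) ht.1 hs.2 (by linarith [hs.1]) (by linarith)
    (by linarith) hts.ne fun t' h1 h2 => by
      rw [hQ.P22hat_zero hd (by linarith [ht.1]) (by linarith) (by linarith), div_zero],
    sub_add_cancel_left, hQ.bdry12 _ hmem, hQ.P11_eq_one hd hmem (by linarith [hs.1]), mul_one]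

theorem P22_transport (hQ : Q.IsSolution d b σ T) (hd : 0 < d) {t s r τ : ℝ} (ht : 0 ≤ t)
    (htd : T - d ≤ t) (hs : s ≤ 0) (hr : r ≤ 0) (hτ : 0 ≤ τ) (htτ : t + τ ≤ T)
    (hsτ : -d ≤ s - τ) (hrτ : -d ≤ r - τ) (hne : t + max s r ≠ T - d) :
    Q.P22 t s r = Q.P22 (t + τ) (s - τ) (r - τ) :=
  hQ.eq22.eq_of_zero ht hs hr hτ htτ hsτ hrτ hne fun t' h1 h2 => by
    rw [hQ.P22hat_zero hd (by linarith) (by linarith) (by linarith), div_zero]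

/-- A kernel `f t s r` that is transported to the boundary `s = -d`, where it is `b * p r`. -/
theorem eq_of_transport_to_boundary {f : ℝ → ℝ → ℝ → ℝ} {p : ℝ → ℝ} {t s r a β : ℝ}
    (har : a < r) (hf : ContinuousOn (fun r' => f t s r') (Ioc a r))
    (hmove : ∀ r' ∈ Ioo a r, f t s r' = f (t + (s + d)) (-d) (r' - (s + d)))
    (hb : ∀ᵐ r' : ℝ, r' ∈ Icc (-d) 0 → f (t + (s + d)) (-d) r' = b * p r')
    (hval : ∀ r' ∈ Ioo a r, r' - (s + d) ∈ Icc (-d) 0 ∧ b * p (r' - (s + d)) = β) :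
    f t s r = β := by
  refine eq_of_ae_eq_Ioo_of_continuousOn_Ioc har hf ?_
  have hb' := (measurePreserving_sub_right volume (s + d)).quasiMeasurePreserving.ae hb
  filter_upwards [hb'] with r' h1 h2
  rw [hmove r' h2, h1 (hval r' h2).1, (hval r' h2).2]

/-- If both `t + s` and `t + r` exceed `T - d`, the characteristic reaches `t = T`, where the kernel
vanishes. If only `t + r` does and `t + s < T - d`, it first meets `s = -d`, where `P₂₂ = b P₁₂ = 0`
almost everywhere by `P12_above`. Continuity on the piece fills in null sets and the case `t + s = T
- d`; the other half is symmetric. -/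
theorem P22_above (hQ : Q.IsSolution d b σ T) (hd : 0 < d) {t s r : ℝ} (ht : t ∈ Icc 0 T)
    (hs : s ∈ Icc (-d) 0) (hr : r ∈ Icc (-d) 0) (h : T - d < t + max s r) :
    Q.P22 t s r = 0 := by
  have hC := hQ.ac22.continuousOn (S := domC₃ d T) (by simp)
  have htd : T - d < t := by linarith [max_le hs.2 hr.2]
  have hboth : ∀ s r, s ≤ 0 → r ≤ 0 → T - d < t + s → T - d < t + r → Q.P22 t s r = 0 :=
    fun s r hs hr h1 h2 => hQ.eq22.eq_zero_above hQ.ac22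
      (fun t s r h0 h1 h2 => by simp only [hQ.P22hat_zero hd h0 h1 h2, div_zero]) hQ.final22 ht
      hs hr h1 h2
  rcases lt_or_ge (T - d) (t + r) with h2 | h2
  · have hmem : ∀ s' ∈ Icc (-d) 0, ∀ r' ∈ Icc (-d) 0, T - d < t + r' →
        (t, s', r') ∈ domC₃ d T := fun s' hs' r' hr' h' =>
      ⟨ht, htd, hs', hr', by simp only; linarith [le_max_right s' r']⟩
    rcases lt_trichotomy (T - d) (t + s) with h1 | h1 | h1
    · exact hboth s r hs.2 hr.2 h1 h2
    · refine eq_of_eq_Ioo_of_continuousOn_Ico (f := fun s' => Q.P22 t s' r) (a := 0)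
        (by linarith) (hC.comp (f := fun s' => (t, s', r)) (by fun_prop) fun s' hs' =>
          hmem s' ⟨hs.1.trans hs'.1, hs'.2.le⟩ r hr h2)
        fun s' hs' => hboth s' r hs'.2.le hr.2 (by linarith [hs'.1]) h2
    · have hT' : t + (s + d) ∈ Icc 0 T := ⟨by linarith [ht.1, hs.1], by linarith⟩
      refine eq_of_transport_to_boundary (f := Q.P22) (a := T - d - t) (p := Q.P12 (t + (s + d)))
        (b := b) (d := d) (by linarith) (hC.comp (f := fun r' => (t, s, r')) (by fun_prop)
          fun r' hr' => hmem s hs r' ⟨by linarith [hr'.1, ht.2], hr'.2.trans hr.2⟩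
            (by linarith [hr'.1])) (fun r' hr' => ?_)
        (hQ.bdry22_left _ hT') (fun r' hr' => ?_)
      · rw [hQ.P22_transport hd (τ := s + d) ht.1 htd.le hs.2 (by linarith [hr'.2, hr.2])
          (by linarith [hs.1]) hT'.2 (by linarith) (by linarith [hr'.1])
          (by linarith [le_max_right s r', hr'.1]), sub_add_cancel_left]
      · have hm : r' - (s + d) ∈ Icc (-d) 0 :=
          ⟨by linarith [hr'.1], by linarith [hr'.2, hr.2, hs.1]⟩
        refine ⟨hm, ?_⟩
        rw [hQ.P12_above hd hT' hm (by linarith [hr'.1]), mul_zero]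
  · have h1 : T - d < t + s := by
      rcases le_total s r with h3 | h3
      · rw [max_eq_right h3] at h; linarith
      · rwa [max_eq_left h3] at h
    have hmem : ∀ s' ∈ Icc (-d) 0, ∀ r' ∈ Icc (-d) 0, T - d < t + s' →
        (t, s', r') ∈ domC₃ d T := fun s' hs' r' hr' h' =>
      ⟨ht, htd, hs', hr', by simp only; linarith [le_max_left s' r']⟩
    rcases h2.eq_or_lt with h2 | h2
    · refine eq_of_eq_Ioo_of_continuousOn_Ico (f := fun r' => Q.P22 t s r') (a := 0)
        (by linarith) (hC.comp (f := fun r' => (t, s, r')) (by fun_prop) fun r' hr' =>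
          hmem s hs r' ⟨hr.1.trans hr'.1, hr'.2.le⟩ h1)
        fun r' hr' => hboth s r' hs.2 hr'.2.le h1 (by linarith [hr'.1])
    · have hT' : t + (r + d) ∈ Icc 0 T := ⟨by linarith [ht.1, hr.1], by linarith⟩
      refine eq_of_transport_to_boundary (f := fun t r s => Q.P22 t s r) (a := T - d - t)
        (p := Q.P12 (t + (r + d)))
        (b := b) (d := d) (by linarith) (hC.comp (f := fun s' => (t, s', r)) (by fun_prop)
          fun s' hs' => hmem s' ⟨by linarith [hs'.1, ht.2], hs'.2.trans hs.2⟩ r hr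
            (by linarith [hs'.1])) (fun s' hs' => ?_)
        (hQ.bdry22_right _ hT') (fun s' hs' => ?_)
      · rw [hQ.P22_transport hd (τ := r + d) ht.1 htd.le (by linarith [hs'.2, hs.2]) hr.2
          (by linarith [hr.1]) hT'.2 (by linarith [hs'.1]) (by linarith)
          (by linarith [le_max_left s' r, hs'.1]), sub_add_cancel_left]
      · have hm : s' - (r + d) ∈ Icc (-d) 0 :=
          ⟨by linarith [hs'.1], by linarith [hs'.2, hs.2, hr.1]⟩
        refine ⟨hm, ?_⟩
        rw [hQ.P12_above hd hT' hm (by linarith [hs'.1]), mul_zero]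

/-- The smaller of `s`, `r` reaches `-d` first, and there the boundary condition gives `b P₁₂ = b *
b`. On the diagonal the line ends at the corner `(-d, -d)`, so the value is taken as a limit from `r
> s`. -/
theorem P22_below (hQ : Q.IsSolution d b σ T) (hd : 0 < d) {t s r : ℝ} (ht : t ∈ Icc 0 T)
    (htd : T - d ≤ t) (hs : s ∈ Icc (-d) 0) (hr : r ∈ Icc (-d) 0) (hts : t + s < T - d)
    (htr : t + r < T - d) : Q.P22 t s r = b * b := by
  -- At `t = T - d` the points belong to the first piece, afterwards to the second.
  have hcont : ∀ S : Set ℝ, ∀ φ ψ : ℝ → ℝ, ContinuousOn φ S → ContinuousOn ψ S →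
      (∀ x ∈ S, φ x ∈ Icc (-d) 0 ∧ ψ x ∈ Icc (-d) 0 ∧ t + φ x < T - d ∧ t + ψ x < T - d) →
      ContinuousOn (fun x => Q.P22 t (φ x) (ψ x)) S := by
    intro S φ ψ hφ hψ h
    rcases htd.eq_or_lt with he | hlt
    · refine (hQ.ac22.continuousOn (S := domA₃ d T) (by simp)).comp
        (f := fun x => (t, φ x, ψ x)) (by fun_prop) fun x hx => ?_
      obtain ⟨h1, h2, -, -⟩ := h x hx
      exact ⟨ht.1, he.ge, h1, h2⟩
    · refine (hQ.ac22.continuousOn (S := domB₃ d T) (by simp)).comp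
        (f := fun x => (t, φ x, ψ x)) (by fun_prop) fun x hx => ?_
      obtain ⟨h1, h2, h3, h4⟩ := h x hx
      refine ⟨ht, hlt, h1, h2, ?_⟩
      simp only
      rw [← max_add_add_left]
      exact max_lt h3 h4
  have hleft : ∀ s r, s ∈ Icc (-d) 0 → r ∈ Icc (-d) 0 → t + r < T - d → s < r →
      Q.P22 t s r = b * b := by
    intro s r hs hr htr hsr
    have hT' : t + (s + d) ∈ Icc 0 T := ⟨by linarith [ht.1, hs.1], by linarith⟩
    refine eq_of_transport_to_boundary (f := Q.P22) (a := s) (p := Q.P12 (t + (s + d)))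
      (b := b) (d := d) hsr (hcont _ _ _ continuousOn_const continuousOn_id fun r' hr' =>
        ⟨hs, ⟨hs.1.trans hr'.1.le, hr'.2.trans hr.2⟩, by linarith,
          by linarith [hr'.2]⟩)
      (fun r' hr' => ?_) (hQ.bdry22_left _ hT') (fun r' hr' => ?_)
    · rw [hQ.P22_transport hd (τ := s + d) ht.1 htd hs.2 (by linarith [hr'.2, hr.2])
        (by linarith [hs.1]) hT'.2 (by linarith) (by linarith [hr'.1])
        (by rw [max_eq_right hr'.1.le]; linarith [hr'.2]), sub_add_cancel_left]
    · have hm : r' - (s + d) ∈ Icc (-d) 0 :=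
        ⟨by linarith [hr'.1], by linarith [hr'.2, hr.2, hs.1]⟩
      refine ⟨hm, ?_⟩
      rw [hQ.P12_below hd hT' (by linarith [hs.1]) hm (by linarith [hr'.2])]
  rcases lt_trichotomy s r with hsr | rfl | hsr
  · exact hleft s r hs hr htr hsr
  · refine eq_of_eq_Ioo_of_continuousOn_Ico (f := fun r' => Q.P22 t s r') (a := T - d - t)
      (by linarith) (hcont _ _ _ continuousOn_const continuousOn_id fun r' hr' =>
        ⟨hs, ⟨hs.1.trans hr'.1, by linarith [hr'.2]⟩, hts,
          by linarith [hr'.2]⟩)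
      fun r' hr' => hleft s r' hs ⟨hs.1.trans hr'.1.le, by linarith [hr'.2]⟩ (by linarith [hr'.2])
        hr'.1
  · have hT' : t + (r + d) ∈ Icc 0 T := ⟨by linarith [ht.1, hr.1], by linarith⟩
    refine eq_of_transport_to_boundary (f := fun t r s => Q.P22 t s r) (a := r)
      (p := Q.P12 (t + (r + d)))
      (b := b) (d := d) hsr (hcont _ _ _ continuousOn_id continuousOn_const fun s' hs' =>
        ⟨⟨hr.1.trans hs'.1.le, hs'.2.trans hs.2⟩, hr, by linarith [hs'.2],
          by linarith⟩)
      (fun s' hs' => ?_) (hQ.bdry22_right _ hT') (fun s' hs' => ?_)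
    · rw [hQ.P22_transport hd (τ := r + d) ht.1 htd (by linarith [hs'.2, hs.2]) hr.2
        (by linarith [hr.1]) hT'.2 (by linarith [hs'.1]) (by linarith)
        (by rw [max_eq_left hs'.1.le]; linarith [hs'.2]), sub_add_cancel_left]
    · have hm : s' - (r + d) ∈ Icc (-d) 0 :=
        ⟨by linarith [hs'.1], by linarith [hs'.2, hs.2, hr.1]⟩
      refine ⟨hm, ?_⟩
      rw [hQ.P12_below hd hT' (by linarith [hr.1]) hm (by linarith [hs'.2])]

end IsSolution

end RiccatiKernel

namespace RiccatiKernel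

variable {d b σ T : ℝ}

/-! ### Compactness of the early-time piece -/

theorem isCompact_domA₂ (d T : ℝ) : IsCompact (domA₂ d T) := by
  have : domA₂ d T = Icc 0 (T - d) ×ˢ Icc (-d) 0 := by
    ext p; simp only [domA₂, mem_prod, mem_Icc]; exact and_assoc.symm
  rw [this]
  exact isCompact_Icc.prod isCompact_Icc

theorem isCompact_domA₃ (d T : ℝ) : IsCompact (domA₃ d T) := by
  have : domA₃ d T = Icc 0 (T - d) ×ˢ Icc (-d) 0 ×ˢ Icc (-d) 0 := by
    ext p; simp only [domA₃, mem_prod, mem_Icc]; exact and_assoc.symm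
  rw [this]
  exact isCompact_Icc.prod (isCompact_Icc.prod isCompact_Icc)

namespace IsSolution

variable {Q : RiccatiKernel}

/-! ### The solution for `t ≤ T - d` -/

/-- Only the corner `(T - d, 0)` is new: its characteristic is excluded from the equation, but it
lies in the first piece, so continuity decides. -/
theorem P22hat_of_le (hQ : Q.IsSolution d b σ T) (hd : 0 < d) {t s : ℝ} (ht : 0 ≤ t)
    (htd : t ≤ T - d) (hs : s ∈ Icc (-d) 0) : Q.P22hat t s = σ ^ 2 * Q.P11 (t + s + d) := by
  have ht' : t ∈ Icc 0 T := ⟨ht, by linarith⟩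
  rcases (by linarith [hs.2] : t + s ≤ T - d).lt_or_eq with h | h
  · exact hQ.P22hat_below ht' hs h
  · have h0 : t = T - d := by linarith [hs.2]
    have h1 : s = 0 := by linarith
    subst h1
    rw [hQ.P11_eq_one hd ⟨by linarith, by linarith⟩ (by linarith)]
    refine eq_of_ae_eq_Ioo_of_continuousOn_Ioc (f := fun s' => Q.P22hat t s') (a := -d)
      (by linarith) ((hQ.ac22hat.continuousOn (S := domA₂ d T) (by simp)).comp
        (f := fun s' => (t, s')) (by fun_prop) fun s' hs' => ⟨ht, htd, hs'.1.le, hs'.2⟩) ?_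
    refine Eventually.of_forall fun s' hs' => ?_
    rw [hQ.P22hat_below ht' ⟨hs'.1.le, hs'.2.le⟩ (by linarith [hs'.2]),
      hQ.P11_eq_one hd ⟨by linarith [hs'.1], by linarith [hs'.2]⟩ (by linarith [hs'.1])]

/-- Including `t = T - d` makes the domain compact, so the quotients by `P̂₂₂` are bounded. -/
theorem P22hat_pos_of_le (hQ : Q.IsSolution d b σ T) (hd : 0 < d) (hσ : σ ≠ 0) {t s : ℝ}
    (ht : 0 ≤ t) (htd : t ≤ T - d) (hs : s ∈ Icc (-d) 0) : 0 < Q.P22hat t s := by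
  rcases htd.lt_or_eq with h | h
  · exact hQ.pos22hat t ⟨ht, by linarith⟩ h s hs
  · rw [hQ.P22hat_of_le hd ht htd hs,
      hQ.P11_eq_one hd ⟨by linarith [hs.1], by linarith [hs.2]⟩ (by linarith [hs.1])]
    positivity

theorem P11_pos (hQ : Q.IsSolution d b σ T) (hd : 0 < d) {t : ℝ}
    (ht : t ∈ Icc 0 T) : 0 < Q.P11 t := by
  rcases lt_or_ge t (T - d) with h | h
  · have h1 := hQ.pos22hat t ht h (-d) ⟨le_rfl, by linarith⟩
    rw [hQ.bdry22hat t ht] at h1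
    exact pos_of_mul_pos_right h1 (sq_nonneg σ)
  · rw [hQ.P11_eq_one hd ht h]
    exact zero_lt_one

/-- With `P22_at`, the terminal data of the backward problem on `t ≤ T - d`: both defects vanish
there. -/
theorem P12_at (hQ : Q.IsSolution d b σ T) (hd : 0 < d) (hT : d ≤ T) {s : ℝ}
    (hs : s ∈ Icc (-d) 0) : Q.P12 (T - d) s = b := by
  have hmem : T - d ∈ Icc 0 T := ⟨by linarith, by linarith⟩
  have hlt : ∀ s ∈ Icc (-d) 0, s < 0 → Q.P12 (T - d) s = b := fun s hs h =>
    hQ.P12_below hd hmem le_rfl hs (by linarith)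
  rcases hs.2.lt_or_eq with h | rfl
  · exact hlt s hs h
  · refine eq_of_ae_eq_Ioo_of_continuousOn_Ioc (f := fun s' => Q.P12 (T - d) s') (a := -d)
      (by linarith) ((hQ.ac12.continuousOn (S := domA₂ d T) (by simp)).comp
        (f := fun s' => (T - d, s')) (by fun_prop)
        fun s' hs' => ⟨hmem.1, le_rfl, hs'.1.le, hs'.2⟩) ?_
    exact Eventually.of_forall fun s' hs' => hlt s' ⟨hs'.1.le, hs'.2.le⟩ hs'.2

theorem P22_at (hQ : Q.IsSolution d b σ T) (hd : 0 < d) (hT : d ≤ T) {s r : ℝ}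
    (hs : s ∈ Icc (-d) 0) (hr : r ∈ Icc (-d) 0) : Q.P22 (T - d) s r = b * b := by
  have hmem : T - d ∈ Icc 0 T := ⟨by linarith, by linarith⟩
  have hA := hQ.ac22.continuousOn (S := domA₃ d T) (by simp)
  have hlt : ∀ s ∈ Icc (-d) 0, ∀ r ∈ Icc (-d) 0, s < 0 → r < 0 → Q.P22 (T - d) s r = b * b :=
    fun s hs r hr h h' => hQ.P22_below hd hmem le_rfl hs hr (by linarith) (by linarith)
  have hlt' : ∀ s ∈ Icc (-d) 0, ∀ r ∈ Icc (-d) 0, s < 0 → Q.P22 (T - d) s r = b * b := by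
    intro s hs r hr h
    rcases hr.2.lt_or_eq with h' | rfl
    · exact hlt s hs r hr h h'
    · refine eq_of_ae_eq_Ioo_of_continuousOn_Ioc (f := fun r' => Q.P22 (T - d) s r') (a := -d)
        (by linarith) (hA.comp (f := fun r' => (T - d, s, r')) (by fun_prop)
          fun r' hr' => ⟨hmem.1, le_rfl, hs, hr'.1.le, hr'.2⟩) ?_
      exact Eventually.of_forall fun r' hr' => hlt s hs r' ⟨hr'.1.le, hr'.2.le⟩ h hr'.2
  rcases hs.2.lt_or_eq with h | rfl
  · exact hlt' s hs r hr h
  · refine eq_of_ae_eq_Ioo_of_continuousOn_Ioc (f := fun s' => Q.P22 (T - d) s' r) (a := -d)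
      (by linarith) (hA.comp (f := fun s' => (T - d, s', r)) (by fun_prop)
        fun s' hs' => ⟨hmem.1, le_rfl, ⟨hs'.1.le, hs'.2⟩, hr⟩) ?_
    exact Eventually.of_forall fun s' hs' => hlt' s' ⟨hs'.1.le, hs'.2.le⟩ r hr hs'.2

theorem continuousOn_P12_of_le (hQ : Q.IsSolution d b σ T) {t : ℝ} (ht : 0 ≤ t)
    (htd : t ≤ T - d) : ContinuousOn (Q.P12 t) (Icc (-d) 0) :=
  (hQ.ac12.continuousOn (S := domA₂ d T) (by simp)).comp (f := fun s => (t, s)) (by fun_prop)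
    fun _ hs => ⟨ht, htd, hs⟩

theorem P22_left_of_le (hQ : Q.IsSolution d b σ T) (hd : 0 < d) {t r : ℝ} (ht : 0 ≤ t)
    (htd : t ≤ T - d) (hr : r ∈ Icc (-d) 0) : Q.P22 t (-d) r = b * Q.P12 t r := by
  refine Measure.eqOn_Icc_of_ae_eq (μ := volume) (f := fun r => Q.P22 t (-d) r)
    (g := fun r => b * Q.P12 t r) (by linarith) ?_ ?_ ?_ hr
  · rw [EventuallyEq, ae_restrict_iff' measurableSet_Icc]
    exact hQ.bdry22_left t ⟨ht, by linarith⟩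
  · exact (hQ.ac22.continuousOn (S := domA₃ d T) (by simp)).comp (f := fun r => (t, -d, r))
      (by fun_prop) fun r hr => ⟨ht, htd, ⟨le_rfl, by linarith⟩, hr⟩
  · exact continuousOn_const.mul (hQ.continuousOn_P12_of_le ht htd)

theorem P22_right_of_le (hQ : Q.IsSolution d b σ T) (hd : 0 < d) {t s : ℝ} (ht : 0 ≤ t)
    (htd : t ≤ T - d) (hs : s ∈ Icc (-d) 0) : Q.P22 t s (-d) = b * Q.P12 t s := by
  refine Measure.eqOn_Icc_of_ae_eq (μ := volume) (f := fun s => Q.P22 t s (-d))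
    (g := fun s => b * Q.P12 t s) (by linarith) ?_ ?_ ?_ hs
  · rw [EventuallyEq, ae_restrict_iff' measurableSet_Icc]
    exact hQ.bdry22_right t ⟨ht, by linarith⟩
  · exact (hQ.ac22.continuousOn (S := domA₃ d T) (by simp)).comp (f := fun s => (t, s, -d))
      (by fun_prop) fun s hs => ⟨ht, htd, hs, ⟨le_rfl, by linarith⟩⟩
  · exact continuousOn_const.mul (hQ.continuousOn_P12_of_le ht htd)

/-- The coefficients of the linear system for the defects `P₁₂ - b P₁₁` and `P₂₂ - b P₁₂` are
bounded. -/
theorem exists_bound_of_le (hQ : Q.IsSolution d b σ T) (hd : 0 < d) (hσ : σ ≠ 0) :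
    ∃ K, 0 ≤ K ∧ ∀ t s, 0 ≤ t → t ≤ T - d → s ∈ Icc (-d) 0 →
      |Q.P12 t 0 / Q.P22hat t 0| ≤ K ∧ |Q.P22 t s 0 / Q.P22hat t 0| ≤ K := by
  have h0 : (0 : ℝ) ∈ Icc (-d) 0 := ⟨by linarith, le_rfl⟩
  have hhat : ContinuousOn (fun p : ℝ × ℝ => Q.P22hat p.1 0) (domA₂ d T) :=
    (hQ.ac22hat.continuousOn (S := domA₂ d T) (by simp)).comp (f := fun p : ℝ × ℝ => (p.1, 0))
      (by fun_prop) fun p hp => ⟨hp.1, hp.2.1, h0⟩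
  have hhat0 : ∀ p ∈ domA₂ d T, Q.P22hat p.1 0 ≠ 0 := fun p hp =>
    (hQ.P22hat_pos_of_le hd hσ hp.1 hp.2.1 h0).ne'
  have h12 : ContinuousOn (fun p : ℝ × ℝ => Q.P12 p.1 0) (domA₂ d T) :=
    (hQ.ac12.continuousOn (S := domA₂ d T) (by simp)).comp (f := fun p : ℝ × ℝ => (p.1, 0))
      (by fun_prop) fun p hp => ⟨hp.1, hp.2.1, h0⟩
  have h22 : ContinuousOn (fun p : ℝ × ℝ => Q.P22 p.1 p.2 0) (domA₂ d T) :=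
    (hQ.ac22.continuousOn (S := domA₃ d T) (by simp)).comp
      (f := fun p : ℝ × ℝ => (p.1, p.2, 0)) (by fun_prop)
      fun p hp => ⟨hp.1, hp.2.1, hp.2.2, h0⟩
  obtain ⟨K, hK⟩ := (isCompact_domA₂ d T).exists_bound_of_continuousOn (h12.div hhat hhat0)
  obtain ⟨K', hK'⟩ := (isCompact_domA₂ d T).exists_bound_of_continuousOn (h22.div hhat hhat0)
  refine ⟨max 0 (max K K'), le_max_left _ _, fun t s ht htd hs => ⟨?_, ?_⟩⟩
  · exact (hK (t, s) ⟨ht, htd, hs⟩).trans ((le_max_left _ _).trans (le_max_right _ _))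
  · exact (hK' (t, s) ⟨ht, htd, hs⟩).trans ((le_max_right _ _).trans (le_max_right _ _))

/-! ### Weighted estimates for the defects -/

theorem exists_defect_bound (hQ : Q.IsSolution d b σ T) (hT : 0 < T) (hd : 0 < d) :
    ∃ M, 0 ≤ M ∧ ∀ t s r, 0 ≤ t → t ≤ T - d → s ∈ Icc (-d) 0 → r ∈ Icc (-d) 0 →
      |Q.P12 t s - b * Q.P11 t| ≤ M ∧ |Q.P22 t s r - b * Q.P12 t s| ≤ M := by
  have h11 : ContinuousOn (fun p : ℝ × ℝ × ℝ => Q.P11 p.1) (domA₃ d T) :=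
    (hQ.continuousOn_P11 hT).comp continuousOn_fst fun p hp => ⟨hp.1, by linarith [hp.2.1]⟩
  have h12 : ContinuousOn (fun p : ℝ × ℝ × ℝ => Q.P12 p.1 p.2.1) (domA₃ d T) :=
    (hQ.ac12.continuousOn (S := domA₂ d T) (by simp)).comp
      (f := fun p : ℝ × ℝ × ℝ => (p.1, p.2.1)) (by fun_prop) fun p hp => ⟨hp.1, hp.2.1, hp.2.2.1⟩
  have h22 := hQ.ac22.continuousOn (S := domA₃ d T) (by simp)
  obtain ⟨K, hK⟩ := (isCompact_domA₃ d T).exists_bound_of_continuousOn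
    (h12.sub (continuousOn_const.mul h11 : ContinuousOn (fun p => b * Q.P11 p.1) _))
  obtain ⟨K', hK'⟩ := (isCompact_domA₃ d T).exists_bound_of_continuousOn
    (h22.sub (continuousOn_const.mul h12 : ContinuousOn (fun p => b * Q.P12 p.1 p.2.1) _))
  refine ⟨max 0 (max K K'), le_max_left _ _, fun t s r ht htd hs hr => ⟨?_, ?_⟩⟩
  · exact (hK (t, s, r) ⟨ht, htd, hs, hr⟩).trans ((le_max_left _ _).trans (le_max_right _ _))
  · exact (hK' (t, s, r) ⟨ht, htd, hs, hr⟩).trans ((le_max_right _ _).trans (le_max_right _ _))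

/-- Along a characteristic, `X' = (P₁₂ (t, 0) / P̂₂₂ (t, 0)) * (Y (t, s, 0) + b X (t, s) - b X (t,
0))`, and `X = 0` where the line leaves through `s = -d` or `t = T - d`. Integrating the exponential
weight gains the factor `1 / l`. -/
theorem abs_P12_sub_le (hQ : Q.IsSolution d b σ T) (hd : 0 < d) {K m l : ℝ}
    (hK0 : 0 ≤ K) (hm : 0 ≤ m) (hl : 0 < l)
    (hK : ∀ t, 0 ≤ t → t ≤ T - d → |Q.P12 t 0 / Q.P22hat t 0| ≤ K)
    (hX : ∀ t s, 0 ≤ t → t ≤ T - d → s ∈ Icc (-d) 0 →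
      |Q.P12 t s - b * Q.P11 t| ≤ m * Real.exp (-l * t))
    (hY : ∀ t s r, 0 ≤ t → t ≤ T - d → s ∈ Icc (-d) 0 → r ∈ Icc (-d) 0 →
      |Q.P22 t s r - b * Q.P12 t s| ≤ m * Real.exp (-l * t))
    {t s : ℝ} (ht : 0 ≤ t) (htd : t ≤ T - d) (hs : s ∈ Icc (-d) 0) :
    |Q.P12 t s - b * Q.P11 t| ≤ K * (1 + 2 * |b|) * m / l * Real.exp (-l * t) := by
  have h0 : (0 : ℝ) ∈ Icc (-d) 0 := ⟨by linarith, le_rfl⟩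
  have hend : ∀ t s, 0 ≤ t → t ≤ T - d → s ∈ Icc (-d) 0 → (t = T - d ∨ s = -d) →
      Q.P12 t s - b * Q.P11 t = 0 := by
    rintro t s ht htd hs (rfl | rfl)
    · rw [hQ.P12_at hd (by linarith) hs, hQ.P11_eq_one hd ⟨ht, by linarith⟩ le_rfl]
      ring
    · rw [hQ.bdry12 t ⟨ht, by linarith⟩, sub_self]
  have hrhs : 0 ≤ K * (1 + 2 * |b|) * m / l * Real.exp (-l * t) := by positivity
  by_cases hcase : t = T - d ∨ s = -d
  · rw [hend t s ht htd hs hcase, abs_zero]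
    exact hrhs
  rw [not_or] at hcase
  have htlt : t < T - d := lt_of_le_of_ne htd hcase.1
  have hslt : -d < s := lt_of_le_of_ne hs.1 (Ne.symm hcase.2)
  -- The exit time of the characteristic from `t ≤ T - d`, `s ≥ -d`.
  set e := min (t + s + d) (T - d) with he
  have hte : t < e := lt_min (by linarith) htlt
  have he1 : e ≤ t + s + d := min_le_left _ _
  have he2 : e ≤ T - d := min_le_right _ _
  have hmax : max 0 (t + s) ≤ t := max_le ht (by linarith [hs.2])
  have hmin : e ≤ min T (t + s + d) := le_min (by linarith) he1
  obtain ⟨hac, hae⟩ := hQ.eq12 (t + s) (by linarith) (by linarith [hs.2])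
  have hac' : AbsolutelyContinuousOnInterval
      (fun t' => Q.P12 t' (t + s - t') - b * Q.P11 t') t e :=
    (hac.mono_Icc hmax hte.le hmin).fun_sub
      ((hQ.ac11.mono_Icc ht hte.le (by linarith)).const_mul b)
  have hbound := hac'.abs_sub_le_of_ae_exp (L := K * (1 + 2 * |b|) * m) (l := l) (by positivity)
    hl le_rfl hte.le le_rfl (by
      filter_upwards [hae, hQ.eq11] with t' h1 h2 hmem
      have h0' : 0 ≤ t' := by linarith [hmem.1]
      have hd' : t' ≤ T - d := by linarith [hmem.2]
      have hs' : t + s - t' ∈ Icc (-d) 0 := ⟨by linarith [hmem.2], by linarith [hmem.1, hs.2]⟩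
      have h3 := (h1 ⟨hmax.trans_lt hmem.1, hmem.2.trans_le hmin⟩).fun_sub
        ((h2 ⟨by linarith [hmem.1], by linarith⟩).const_mul b)
      rw [h3.deriv]
      have e1 : Q.P12 t' 0 * Q.P22 t' (t + s - t') 0 / Q.P22hat t' 0
            - b * (Q.P12 t' 0 ^ 2 / Q.P22hat t' 0)
          = Q.P12 t' 0 / Q.P22hat t' 0 *
            ((Q.P22 t' (t + s - t') 0 - b * Q.P12 t' (t + s - t'))
              + b * (Q.P12 t' (t + s - t') - b * Q.P11 t')
              - b * (Q.P12 t' 0 - b * Q.P11 t')) := by ring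
      have hY' := hY t' _ 0 h0' hd' hs' h0
      have hX1 := hX t' _ h0' hd' hs'
      have hX2 := hX t' 0 h0' hd' h0
      rw [e1, abs_mul, mul_assoc, mul_assoc]
      refine mul_le_mul (hK t' h0' hd') ?_ (abs_nonneg _) hK0
      refine (abs_sub _ _).trans ?_
      refine (add_le_add_left (abs_add_le _ _) _).trans ?_
      rw [abs_mul, abs_mul]
      have hb1 := mul_le_mul_of_nonneg_left hX1 (abs_nonneg b)
      have hb2 := mul_le_mul_of_nonneg_left hX2 (abs_nonneg b)
      linarith)
  have hz := hend e (t + s - e) (by linarith) he2 ⟨by linarith, by linarith [hs.2]⟩ (by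
    rcases min_choice (t + s + d) (T - d) with h | h
    · right; rw [he, h]; ring
    · left; rw [he, h])
  simp only [hz, zero_sub, abs_neg, add_sub_cancel_left] at hbound
  exact hbound

/-- Here `Y' = (P₂₂ (t, s, 0) / P̂₂₂ (t, 0)) * Y (t, 0, r)`. At the exit `Y` is zero, except on `s =
-d`, where `Y = b X (t, r)`. This term gains no `1 / l`, so a separate constant `m'` admits the
already improved bound on `X`. -/
theorem abs_P22_sub_le (hQ : Q.IsSolution d b σ T) (hd : 0 < d) {K m m' l : ℝ}
    (hK0 : 0 ≤ K) (hm : 0 ≤ m) (hm' : 0 ≤ m') (hl : 0 < l)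
    (hK : ∀ t s, 0 ≤ t → t ≤ T - d → s ∈ Icc (-d) 0 → |Q.P22 t s 0 / Q.P22hat t 0| ≤ K)
    (hX : ∀ t s, 0 ≤ t → t ≤ T - d → s ∈ Icc (-d) 0 →
      |Q.P12 t s - b * Q.P11 t| ≤ m' * Real.exp (-l * t))
    (hY : ∀ t s r, 0 ≤ t → t ≤ T - d → s ∈ Icc (-d) 0 → r ∈ Icc (-d) 0 →
      |Q.P22 t s r - b * Q.P12 t s| ≤ m * Real.exp (-l * t))
    {t s r : ℝ} (ht : 0 ≤ t) (htd : t ≤ T - d) (hs : s ∈ Icc (-d) 0) (hr : r ∈ Icc (-d) 0) :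
    |Q.P22 t s r - b * Q.P12 t s| ≤ (|b| * m' + K * m / l) * Real.exp (-l * t) := by
  have h0 : (0 : ℝ) ∈ Icc (-d) 0 := ⟨by linarith, le_rfl⟩
  have hend : ∀ t' s r, t ≤ t' → t' ≤ T - d → s ∈ Icc (-d) 0 → r ∈ Icc (-d) 0 →
      (t' = T - d ∨ s = -d ∨ r = -d) →
      |Q.P22 t' s r - b * Q.P12 t' s| ≤ |b| * m' * Real.exp (-l * t) := by
    rintro t' s r ht' htd hs hr h
    have hrhs : 0 ≤ |b| * m' * Real.exp (-l * t) := by positivity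
    rcases h with rfl | rfl | rfl
    · rw [hQ.P12_at hd (by linarith) hs, hQ.P22_at hd (by linarith) hs hr, sub_self, abs_zero]
      exact hrhs
    · rw [hQ.P22_left_of_le hd (by linarith) htd hr, hQ.bdry12 t' ⟨by linarith, by linarith⟩,
        ← mul_sub, abs_mul, mul_assoc]
      refine mul_le_mul_of_nonneg_left ((hX t' r (by linarith) htd hr).trans ?_) (abs_nonneg b)
      refine mul_le_mul_of_nonneg_left (Real.exp_le_exp.2 ?_) hm'
      nlinarith
    · rw [hQ.P22_right_of_le hd (by linarith) htd hs, sub_self, abs_zero]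
      exact hrhs
  have hnn : 0 ≤ K * m / l * Real.exp (-l * t) := by positivity
  rw [add_mul]
  by_cases hcase : t = T - d ∨ s = -d ∨ r = -d
  · linarith [hend t s r le_rfl htd hs hr hcase]
  simp only [not_or] at hcase
  have htlt : t < T - d := lt_of_le_of_ne htd hcase.1
  have hslt : -d < s := lt_of_le_of_ne hs.1 (Ne.symm hcase.2.1)
  have hrlt : -d < r := lt_of_le_of_ne hr.1 (Ne.symm hcase.2.2)
  set e := min (min (t + s) (t + r) + d) (T - d) with he
  have hms : min (t + s) (t + r) ≤ t + s := min_le_left _ _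
  have hmr : min (t + s) (t + r) ≤ t + r := min_le_right _ _
  have hte : t < e := by
    refine lt_min ?_ htlt
    have : t - d < min (t + s) (t + r) := lt_min (by linarith) (by linarith)
    linarith
  have he1 : e ≤ min (t + s) (t + r) + d := min_le_left _ _
  have he2 : e ≤ T - d := min_le_right _ _
  have hmax1 : max (t + s) (t + r) ≤ t := max_le (by linarith [hs.2]) (by linarith [hr.2])
  have hmax : max 0 (max (t + s) (t + r)) ≤ t := max_le ht hmax1
  have hmin : e ≤ min T (min (t + s) (t + r) + d) := le_min (by linarith) he1
  obtain ⟨hac, hae⟩ := hQ.eq22 (t + s) (t + r) (by linarith) (by linarith)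
  have hmax₂ : max 0 (t + s) ≤ t := max_le ht (by linarith [hs.2])
  have hmin₂ : e ≤ min T (t + s + d) := le_min (by linarith) (by linarith)
  obtain ⟨hac₂, hae₂⟩ := hQ.eq12 (t + s) (by linarith) (by linarith [hs.2])
  have hac' : AbsolutelyContinuousOnInterval
      (fun t' => Q.P22 t' (t + s - t') (t + r - t') - b * Q.P12 t' (t + s - t')) t e :=
    (hac.mono_Icc hmax hte.le hmin).fun_sub ((hac₂.mono_Icc hmax₂ hte.le hmin₂).const_mul b)
  have hbound := hac'.abs_sub_le_of_ae_exp (L := K * m) (l := l) (by positivity)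
    hl le_rfl hte.le le_rfl (by
      filter_upwards [hae, hae₂] with t' h1 h2 hmem
      have h0' : 0 ≤ t' := by linarith [hmem.1]
      have hd' : t' ≤ T - d := by linarith [hmem.2]
      have hs' : t + s - t' ∈ Icc (-d) 0 := ⟨by linarith [hmem.2], by linarith [hmem.1, hs.2]⟩
      have hr' : t + r - t' ∈ Icc (-d) 0 := ⟨by linarith [hmem.2], by linarith [hmem.1, hr.2]⟩
      have h3 := (h1 ⟨hmax.trans_lt hmem.1, hmem.2.trans_le hmin⟩).fun_sub
        ((h2 ⟨hmax₂.trans_lt hmem.1, hmem.2.trans_le hmin₂⟩).const_mul b)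
      rw [h3.deriv]
      have e1 : Q.P22 t' (t + s - t') 0 * Q.P22 t' 0 (t + r - t') / Q.P22hat t' 0
            - b * (Q.P12 t' 0 * Q.P22 t' (t + s - t') 0 / Q.P22hat t' 0)
          = Q.P22 t' (t + s - t') 0 / Q.P22hat t' 0 *
            (Q.P22 t' 0 (t + r - t') - b * Q.P12 t' 0) := by ring
      rw [e1, abs_mul, mul_assoc]
      exact mul_le_mul (hK t' _ h0' hd' hs') (hY t' 0 _ h0' hd' h0 hr') (abs_nonneg _) hK0)
  have hz := hend e (t + s - e) (t + r - e) hte.le he2 ⟨by linarith, by linarith [hs.2]⟩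
    ⟨by linarith, by linarith [hr.2]⟩ (by
    rcases min_choice (min (t + s) (t + r) + d) (T - d) with h | h
    · right
      rcases min_choice (t + s) (t + r) with h' | h'
      · left; rw [he, h, h']; ring
      · right; rw [he, h, h']; ring
    · left; rw [he, h])
  simp only [add_sub_cancel_left] at hbound
  rw [abs_sub_comm] at hbound
  have := abs_sub_abs_le_abs_sub (Q.P22 t s r - b * Q.P12 t s)
    (Q.P22 e (t + s - e) (t + r - e) - b * Q.P12 e (t + s - e))
  linarith

/-- For `t ≤ T - d` the kernels `P₁₂` and `P₂₂` are determined by `P₁₁`. -/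
theorem kernels_of_le (hQ : Q.IsSolution d b σ T) (hd : 0 < d) (hT : 0 < T) (hσ : σ ≠ 0)
    {t s r : ℝ} (ht : 0 ≤ t) (htd : t ≤ T - d) (hs : s ∈ Icc (-d) 0) (hr : r ∈ Icc (-d) 0) :
    Q.P12 t s = b * Q.P11 t ∧ Q.P22 t s r = b ^ 2 * Q.P11 t := by
  obtain ⟨K, hK0, hK⟩ := hQ.exists_bound_of_le hd hσ
  obtain ⟨M, hM0, hM⟩ := hQ.exists_defect_bound hT hd
  have h0 : (0 : ℝ) ∈ Icc (-d) 0 := ⟨by linarith, le_rfl⟩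
  set A := K * (1 + 2 * |b|) with hA
  have hA0 : 0 ≤ A := by positivity
  have hKA : K ≤ A := by
    have : 0 ≤ K * (2 * |b|) := by positivity
    rw [hA]; linarith
  -- Large enough that `A / l` and `(|b| A + K) / l` are both at most `1 / 2`: each pass halves both
  -- bounds.
  set l := 2 * (A * (1 + |b|) + 1) with hl
  have hl0 : 0 < l := by positivity
  set m₀ := M * Real.exp (l * (T - d)) with hm₀
  have key : ∀ n : ℕ, ∀ t s r, 0 ≤ t → t ≤ T - d → s ∈ Icc (-d) 0 → r ∈ Icc (-d) 0 →
      |Q.P12 t s - b * Q.P11 t| ≤ m₀ * (1 / 2) ^ n * Real.exp (-l * t) ∧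
      |Q.P22 t s r - b * Q.P12 t s| ≤ m₀ * (1 / 2) ^ n * Real.exp (-l * t) := by
    intro n
    induction n with
    | zero =>
      intro t s r ht htd hs hr
      have : M ≤ m₀ * (1 / 2) ^ 0 * Real.exp (-l * t) := by
        rw [hm₀, pow_zero, mul_one, mul_assoc, ← Real.exp_add]
        refine le_mul_of_one_le_right hM0 (Real.one_le_exp ?_)
        nlinarith
      exact ⟨(hM t s r ht htd hs hr).1.trans this, (hM t s r ht htd hs hr).2.trans this⟩
    | succ n ih =>
      intro t s r ht htd hs hr
      set m := m₀ * (1 / 2) ^ n with hm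
      have hm0 : 0 ≤ m := by positivity
      have hms : m₀ * (1 / 2) ^ (n + 1) = m / 2 := by rw [hm, pow_succ]; ring
      have hX := fun t s ht htd hs => (ih t s 0 ht htd hs h0).1
      have hY := fun t s r ht htd hs hr => (ih t s r ht htd hs hr).2
      have hX' : ∀ t s, 0 ≤ t → t ≤ T - d → s ∈ Icc (-d) 0 →
          |Q.P12 t s - b * Q.P11 t| ≤ A * m / l * Real.exp (-l * t) := fun t s ht htd hs =>
        hQ.abs_P12_sub_le hd hK0 hm0 hl0 (fun t ht htd => (hK t 0 ht htd h0).1) hX hY ht htd hs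
      have hY' := hQ.abs_P22_sub_le hd (m' := A * m / l) hK0 hm0 (by positivity) hl0
        (fun t s ht htd hs => (hK t s ht htd hs).2) hX' hY ht htd hs hr
      have hAm : 0 ≤ A * m := by positivity
      have hbAm : 0 ≤ |b| * (A * m) := by positivity
      have hKm : K * m ≤ A * m := by gcongr
      rw [hms]
      refine ⟨(hX' t s ht htd hs).trans ?_, hY'.trans ?_⟩
      · refine mul_le_mul_of_nonneg_right ?_ (Real.exp_pos _).le
        rw [div_le_div_iff₀ hl0 two_pos, hl]
        nlinarith
      · refine mul_le_mul_of_nonneg_right ?_ (Real.exp_pos _).le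
        rw [← mul_div_assoc, ← add_div, div_le_div_iff₀ hl0 two_pos, hl]
        nlinarith
  have hlim : Tendsto (fun n : ℕ => m₀ * (1 / 2) ^ n * Real.exp (-l * t)) atTop (𝓝 0) := by
    have := ((tendsto_pow_atTop_nhds_zero_of_lt_one (r := (1 / 2 : ℝ)) (by norm_num)
      (by norm_num)).const_mul m₀).mul_const (Real.exp (-l * t))
    simpa using this
  have h1 : Q.P12 t s - b * Q.P11 t = 0 := abs_eq_zero.1 (le_antisymm
    (ge_of_tendsto' hlim fun n => (key n t s r ht htd hs hr).1) (abs_nonneg _))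
  have h2 : Q.P22 t s r - b * Q.P12 t s = 0 := abs_eq_zero.1 (le_antisymm
    (ge_of_tendsto' hlim fun n => (key n t s r ht htd hs hr).2) (abs_nonneg _))
  have h3 : Q.P12 t s = b * Q.P11 t := by linarith
  refine ⟨h3, ?_⟩
  rw [h3] at h2
  linear_combination h2

/-- The first component of a solution is the inverse of the delayed exponential. -/
theorem P11_eq (hQ : Q.IsSolution d b σ T) (hd : 0 < d) (hT : 0 < T) (hσ : σ ≠ 0) {M : ℕ}
    (hM : M ≠ 0) (hTM : T ≤ M * d) {t : ℝ} (ht : t ∈ Icc 0 T) :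
    Q.P11 t = (delayExp ((b / σ) ^ 2) d T M t)⁻¹ := by
  set q := delayExp ((b / σ) ^ 2) d T M with hq
  -- Method of steps: both derivatives at `t` depend only on the value at `t + d`, so agreement
  -- extends by `d` to the left each time.
  suffices h : ∀ n : ℕ, ∀ t ∈ Icc 0 T, T - d - n * d ≤ t → (Q.P11 t)⁻¹ = q t by
    rw [← h M t ht (by linarith [ht.1]), inv_inv]
  -- The positive minimum of `P₁₁` makes its inverse absolutely continuous.
  obtain ⟨x, hx, hmin⟩ := isCompact_Icc.exists_isMinOn (nonempty_Icc.2 hT.le)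
    (hQ.continuousOn_P11 hT)
  have hinv : AbsolutelyContinuousOnInterval (fun t => (Q.P11 t)⁻¹) 0 T :=
    hQ.ac11.fun_inv_of_le (hQ.P11_pos hd hx) fun y hy => hmin (by rwa [uIcc_of_le hT.le] at hy)
  have hac := hinv.fun_sub (absolutelyContinuousOnInterval_delayExp ((b / σ) ^ 2) d T M 0 T)
  have hone : ∀ t ∈ Icc 0 T, T - d ≤ t → (Q.P11 t)⁻¹ = q t := by
    intro t ht h
    rw [hQ.P11_eq_one hd ht h, hq, delayExp_of_le hd.le M h, inv_one]
  intro n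
  induction n with
  | zero => intro t ht h; exact hone t ht (by simpa using h)
  | succ n ih =>
    intro t ht h
    rcases le_or_gt (T - d) t with h' | h'
    · exact hone t ht h'
    have hne : ∀ᵐ t : ℝ, ∀ k : ℕ, t ≠ T - k * d := ae_all_iff.2 fun k => by simp [ae_iff]
    have := hac.eq_of_ae_hasDerivAt_zero (x := t) (y := T - d) ht.1 h'.le (by linarith) (by
      filter_upwards [hQ.eq11, hne] with t' h1 h2 hmem
      have h0' : 0 ≤ t' := by linarith [ht.1, hmem.1]
      have hpos := hQ.P11_pos hd (t := t') ⟨h0', by linarith [hmem.2]⟩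
      have hpos' := hQ.P11_pos hd (t := t' + d) ⟨by linarith, by linarith [hmem.2]⟩
      have h3 := (h1 ⟨by linarith [ht.1, hmem.1], by linarith [hmem.2]⟩).fun_inv hpos.ne'
      have h4 := hasDerivAt_delayExp_of_lt (c := (b / σ) ^ 2) hM hmem.2
        (by linarith) h2
      have h5 := ih (t' + d) ⟨by linarith, by linarith [hmem.2]⟩
        (by push_cast at h; linarith [hmem.1])
      convert! h3.fun_sub h4 using 1
      have hz : (0 : ℝ) ∈ Icc (-d) 0 := ⟨by linarith, le_rfl⟩
      rw [← hq, ← h5, (hQ.kernels_of_le hd hT hσ h0' hmem.2.le hz hz).1,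
        hQ.P22hat_of_le hd h0' hmem.2.le hz, add_zero]
      field_simp
      ring)
    have h6 := hone (T - d) ⟨by linarith [ht.1], by linarith⟩ le_rfl
    simp only [← hq, h6, sub_self] at this
    linarith

/-- Every solution coincides with the explicit one. -/
theorem agree_ofFun (hQ : Q.IsSolution d b σ T) (hd : 0 < d) (hT : 0 < T) (hσ : σ ≠ 0)
    {p : ℝ → ℝ} (hp : ∀ t ∈ Icc 0 T, Q.P11 t = p t) : Agree d T (ofFun d b σ T p) Q := by
  refine ⟨fun t ht => (hp t ht).symm, ?_, ?_⟩
  · rintro ⟨t, s⟩ ((h | h) | h)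
    · obtain ⟨h0, h1, hs⟩ := h
      simp only at h0 h1 hs
      have hle : t + s ≤ T - d := by linarith [hs.2]
      simp only [ofFun, if_pos hle]
      rw [(hQ.kernels_of_le hd hT hσ h0 h1 hs hs).1, hQ.P22hat_of_le hd h0 h1 hs,
        hp t ⟨h0, by linarith⟩, hp (t + s + d) ⟨by linarith [hs.1], by linarith⟩]
      exact ⟨rfl, rfl⟩
    · obtain ⟨h0, h1, hs, h2⟩ := h
      simp only at h0 h1 hs h2
      simp only [ofFun, if_pos h2.le]
      rw [hQ.P12_below hd h0 h1.le hs h2, hQ.P22hat_below h0 hs h2, ← hp t h0,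
        hQ.P11_eq_one hd h0 h1.le, hp (t + s + d) ⟨by linarith [hs.1, h0.1], by linarith⟩]
      exact ⟨mul_one b, rfl⟩
    · obtain ⟨h0, h1, hs, h2⟩ := h
      simp only at h0 h1 hs h2
      simp only [ofFun, if_neg (not_le.2 h2)]
      exact ⟨(hQ.P12_above hd h0 hs h2).symm, (hQ.P22hat_above h0 hs h2).symm⟩
  · rintro ⟨t, s, r⟩ ((h | h) | h)
    · obtain ⟨h0, h1, hs, hr⟩ := h
      simp only at h0 h1 hs hr
      have hle : t + max s r ≤ T - d := by linarith [max_le hs.2 hr.2]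
      simp only [ofFun, if_pos hle]
      rw [(hQ.kernels_of_le hd hT hσ h0 h1 hs hr).2, hp t ⟨h0, by linarith⟩]
    · obtain ⟨h0, h1, hs, hr, h2⟩ := h
      simp only at h0 h1 hs hr h2
      simp only [ofFun, if_pos h2.le]
      rw [hQ.P22_below hd h0 h1.le hs hr (by linarith [le_max_left s r])
        (by linarith [le_max_right s r]), ← hp t h0, hQ.P11_eq_one hd h0 h1.le]
      ring
    · obtain ⟨h0, h1, hs, hr, h2⟩ := h
      simp only at h0 h1 hs hr h2
      simp only [ofFun, if_neg (not_le.2 h2)]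
      exact (hQ.P22_above hd h0 hs hr h2).symm

end IsSolution

end RiccatiKernel

/-! ### Existence, uniqueness and bounds at time zero -/

theorem mainTheorem3 (d b σ T : ℝ) (hd : 0 < d) (hσ : σ ≠ 0) (hT : 0 < T)
    (ha : 0 < riccatiSeq d b σ 1) (hN : 2 ≤ riccatiIndex d b σ)
    (hTN : T < riccatiIndex d b σ * d) :
    ∃ P : RiccatiKernel, P.IsSolution d b σ T ∧
      (∀ Q : RiccatiKernel, Q.IsSolution d b σ T → RiccatiKernel.Agree d T P Q) ∧
      0 < riccatiSeq d b σ (riccatiIndex d b σ) ∧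
      riccatiSeq d b σ (riccatiIndex d b σ) ≤ P.P11 0 ∧
      P.P11 0 ≤ 1 ∧ (d < T → P.P11 0 < 1) := by
  set N := riccatiIndex d b σ with hNdef
  have hN0 : N ≠ 0 := by omega
  have hb : b ≠ 0 := ne_zero_of_one_le_riccatiIndex (one_le_two.trans hN)
  -- Truncating at `N` loses nothing on `[0, T]`, since `T < N * d`.
  set q := delayExp ((b / σ) ^ 2) d T N with hq
  have hq1 : 1 ≤ q 0 := one_le_delayExp (sq_nonneg _) N 0
  refine ⟨RiccatiKernel.ofFun d b σ T fun t => (q t)⁻¹,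
    RiccatiKernel.isSolution_delayExp hd hσ hN0 hTN.le,
    fun Q hQ => hQ.agree_ofFun hd hT hσ fun t ht => hQ.P11_eq hd hT hσ hN0 hTN.le ht,
    riccatiSeq_pos_of_le_riccatiIndex ha le_rfl, ?_, inv_le_one_of_one_le₀ hq1,
    fun h => inv_lt_one_of_one_lt₀ (one_lt_delayExp_zero (by positivity) h hN0)⟩
  have hle : q 0 ≤ (1 + (b / σ) ^ 2 * d) ^ N := delayExp_zero_le (sq_nonneg _) hd.le hTN.le
  have hpos := riccatiSeq_pos_of_le_riccatiIndex ha (n := N) le_rfl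
  have hone := riccatiSeq_mul_pow_le_one hd.le (n := N)
    fun k hk => riccatiSeq_pos_of_le_riccatiIndex ha hk
  change riccatiSeq d b σ N ≤ (q 0)⁻¹
  -- The chain is `q 0 ≤ (1 + c d) ^ N ≤ 1 / a_N`.
  rw [le_inv_comm₀ hpos (by linarith)]
  refine hle.trans ?_
  rw [← one_div, le_div_iff₀ hpos, mul_comm]
  exact hone
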